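/- Let $S$ be a scheme, let $R, X$ be $S$-schemes and let $p_1,p_2 : R \rightrightarrows X$ be $S$-morphisms forming an equivalence relation over $S$; that is, for every $S$-scheme $U$ the map $(p_1,p_2): R(U)\to X(U)\times X(U)$ is injective and its image is the graph of an equivalence relation on $X(U)=\mathrm{Hom}_S(U,X)$. Assume that (a) $p_1$ is finite locally free, i.e. $p_1$ is finite and $p_{1*}\mathcal O_R$ is a locally free $\mathcal O_X$-module; (b) for every point $x\in X$, the set $p_1(p_2^{-1}(x))$ is contained in an affine open subscheme of $X$. Then $p_2$ is also finite locally free, and there is an $S$-morphism $\pi : X\to Q$ of $S$-schemes with $\pi p_1=\pi p_2$ such that: (i) $\pi$ is a cokernel (coequalizer) of $(p_1,p_2)$ in the category of $S$-schemes, and also in the category of all ringed spaces; (ii) $\pi$ is finite locally free; (iii) the morphism $(p_1,p_2): R\to X\times_Q X$ is an isomorphism; (iv) $Q$, together with $\pi$, represents the fppf quotient sheaf of $X$ by $R$, i.e. the sheaf on $(\mathrm{Sch}/S)_{\mathrm{fppf}}$ associated to the presheaf $U\mapsto X(U)/R(U)$; (v) the formation of the quotient commutes with base change: for every $S$-morphism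 $Q'\to Q$ of $S$-schemes, let $p_1',p_2' : R\times_Q Q'\rightrightarrows X\times_Q Q'$ be the base changes of $p_1,p_2$. Then the projection $X\times_Q Q'\to Q'$ is a cokernel of $(p_1',p_2')$ in the category of $S$-schemes and in the category of all ringed spaces, and $Q'$ represents the fppf quotient sheaf of $X\times_Q Q'$ by $R\times_Q Q'$. -/

import Mathlib

open CategoryTheory CategoryTheory.Limits AlgebraicGeometry Opposite

universe u v w

namespace SchemeQuotient

/-- A morphism of schemes `f : X ⟶ Y` is finite locally free if it is finite and `f_* 𝒪_X` is a
locally free `𝒪_Y`-module. As `f` is affine, the latter means that every point of `Y` has an affine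
open neighbourhood `V` such that `Γ(X, f ⁻¹ V)` is a free `Γ(Y, V)`-module (of finite rank, since
`f` is finite). -/
structure IsFiniteLocallyFree {X Y : Scheme.{u}} (f : X ⟶ Y) : Prop where
  isFinite : IsFinite f
  locallyFree : ∀ y : Y, ∃ V : Y.Opens, IsAffineOpen V ∧ y ∈ V ∧
    letI : Module Γ(Y, V) Γ(X, f ⁻¹ᵁ V) := (f.app V).hom.toModule
    Module.Free Γ(Y, V) Γ(X, f ⁻¹ᵁ V)

/-- In any category, `π : X ⟶ Q` is a cokernel (coequalizer) of the pair `p₁, p₂ : R ⟶ X` if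
`p₁ ≫ π = p₂ ≫ π` and `π` is universal with this property. -/
def IsCokernel {C : Type w} [Category.{v} C] {R X Q : C} (p₁ p₂ : R ⟶ X) (π : X ⟶ Q) : Prop :=
  ∃ h : p₁ ≫ π = p₂ ≫ π, Nonempty (IsColimit (Cofork.ofπ π h))

/-- The functor from `S`-schemes to the category of all ringed spaces. -/
noncomputable def toRingedSpace (S : Scheme.{u}) : Over S ⥤ RingedSpace.{u, u} :=
  Over.forget S ⋙ Scheme.forgetToLocallyRingedSpace ⋙ LocallyRingedSpace.forgetToSheafedSpace

section Presheaf

variable {C : Type w} [Category.{v} C] {R X Q : C}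

/-- Two `U`-points of `X` are related if they are the two components of a `U`-point of `R`. -/
def Related (p₁ p₂ : R ⟶ X) (U : C) (x y : U ⟶ X) : Prop :=
  ∃ r : U ⟶ R, r ≫ p₁ = x ∧ r ≫ p₂ = y

/-- The presheaf `U ↦ X(U) / R(U)`. -/
def quotientPresheaf (p₁ p₂ : R ⟶ X) : Cᵒᵖ ⥤ Type v where
  obj U := Quot (Related p₁ p₂ U.unop)
  map {U V} f := ↾(Quot.map (fun x => f.unop ≫ x) (by
    rintro x y ⟨r, rfl, rfl⟩
    exact ⟨f.unop ≫ r, by simp, by simp⟩))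
  map_id U := by
    ext x
    induction x using Quot.ind
    simp [Quot.map]
  map_comp f g := by
    ext x
    induction x using Quot.ind
    simp [Quot.map]

/-- The morphism from the presheaf `U ↦ X(U) / R(U)` to the functor of points of `Q` induced by a
morphism `π : X ⟶ Q` such that `p₁ ≫ π = p₂ ≫ π`. -/
def quotientPresheafDesc (p₁ p₂ : R ⟶ X) (π : X ⟶ Q) (h : p₁ ≫ π = p₂ ≫ π) :
    quotientPresheaf p₁ p₂ ⟶ yoneda.obj Q where
  app U := ↾(Quot.lift (fun x => x ≫ π) (by
    rintro x y ⟨r, rfl, rfl⟩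
    simp [h]))
  naturality U V f := by
    ext x
    induction x using Quot.ind
    simp [quotientPresheaf, Quot.map]

/-- `φ : P ⟶ F` exhibits `F` as the sheaf associated to the presheaf `P`: `F` is a sheaf and every
morphism from `P` to a sheaf factors uniquely through `φ`. The two local conditions are the usual
concrete description of the associated sheaf (they do not refer to a universe of test sheaves). -/
structure IsAssociatedSheaf (J : GrothendieckTopology C) {P F : Cᵒᵖ ⥤ Type v} (φ : P ⟶ F) :
    Prop where
  isSheaf : Presheaf.IsSheaf J F
  existsUnique : ∀ (G : Cᵒᵖ ⥤ Type v), Presheaf.IsSheaf J G → ∀ ψ : P ⟶ G,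
    ∃! χ : F ⟶ G, φ ≫ χ = ψ
  isLocallyInjective : Presheaf.IsLocallyInjective J φ
  isLocallySurjective : Presheaf.IsLocallySurjective J φ

end Presheaf

/-- `Q`, with the morphism `π : X ⟶ Q`, represents the fppf quotient sheaf of `X` by `R` on the
category of `S`-schemes. -/
def RepresentsFppfQuotient {S : Scheme.{u}} {R X Q : Over S} (p₁ p₂ : R ⟶ X) (π : X ⟶ Q) : Prop :=
  ∃ h : p₁ ≫ π = p₂ ≫ π,
    IsAssociatedSheaf (Scheme.fppfTopology.over S) (quotientPresheafDesc p₁ p₂ π h)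

section BaseChange

variable {C : Type w} [Category.{v} C] [HasPullbacks C] {R X Q Q' : C}

/-- The base change `R ×_Q Q' ⟶ X ×_Q Q'` of a morphism `p : R ⟶ X` along `g : Q' ⟶ Q`, where `R`
is an object over `Q` through `ρ` and `X` through `π`. -/
noncomputable def baseChange (p : R ⟶ X) (ρ : R ⟶ Q) (π : X ⟶ Q) (h : p ≫ π = ρ) (g : Q' ⟶ Q) :
    pullback ρ g ⟶ pullback π g :=
  pullback.lift (pullback.fst ρ g ≫ p) (pullback.snd ρ g) (by
    rw [Category.assoc, h, pullback.condition])

end BaseChange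

end SchemeQuotient

open SchemeQuotient

/-!
The quotient is first constructed over saturated affine open subsets of `X` over which `p₁` is free,
and these quotients are glued.

*The affine case.* Let `A` and `B` be the rings of functions of `X` and `R`, let `s, t : A → B` be
the pullbacks along `p₁` and `p₂`, and let `A₀` be the ring of invariants, on which `s = t`. The
characteristic polynomial of multiplication by `t a` on the `s`-module `B` is invariant, since the
scheme of triples `x ∼ y ∼ z` is in two ways a base change of `p₁`, through `(x, y) ↦ x` and through
`(x, y) ↦ y` (`IsCogroupoid.map_charpoly`). Hence `A` is integral over `A₀`. As `R ⟶ X × X` is a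
finite monomorphism, `B` is spanned over `s A` by finitely many elements `t (g j)`
(`IsRelation.exists_eq_sum`). The heart of the argument is `IsCogroupoid.exists_dual`: there are
`s`-linear coordinates `Φ j : B → A` with `x = ∑ j, s (Φ j x) * t (g j)` that take invariant values
on `t A`. If the `t (g j)` formed a basis, its coordinates would do. In general some linear
combinations of them form a basis only locally on `Spec A₀` and after an extension of residue
fields; to avoid both, the combinations are taken with indeterminate coefficients. Their determinant
is not invertible but divides its norm, an invariant polynomial whose coefficients generate the
unit ideal of `A₀`, and a comparison of coefficients yields the `Φ j`. They form a dual basis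
of `A` over `A₀`, so that `A` is finite projective over `A₀`, and they show that `B` is the tensor
square of `A` over `A₀`.

*Saturated affine neighbourhoods.* If the equivalence class of a point lies in an affine open
subset `U`, then `p₁` is free over some principal open subset `V` of `U` that contains the class,
because the rank of `p₁` is constant on the class and a module of constant rank over a semilocal
ring is free. The largest saturated subset of `V` is the nonvanishing locus of a norm along `p₁`
and hence affine (`IsRelation.exists_isSaturated_isAffineOpen`).

*Gluing and consequences.* The predicate `IsQuotient` says that `π` is finite, flat, of finite
presentation and surjective, and that two points of `X` with values in any scheme have the same
image under `π` if and only if they are related. This determines `π` up to isomorphism, because `π`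
is an effective epimorphism, and it is local on `Q` and stable under base change. All the assertions
about the quotient follow from it: the cokernel property for schemes and the description of the fppf
quotient sheaf by fppf descent along `π`, and the cokernel property for ringed spaces because `Q` has
the quotient topology and, by descent of morphisms to affine schemes, its functions are the
invariant functions on `X`.
-/

namespace SchemeQuotient

/-! ### Bases along ring homomorphisms -/

section IsBasisAlong

variable {A B D ι : Type*} [CommRing A] [CommRing B] [CommRing D] [Fintype ι]

/-- The family `b` is a basis of `B`, considered as a module over `A` through the ring homomorphism
`s : A →+* B`. As several homomorphisms `A →+* B` are used at the same time, none of them is turned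
into an algebra structure. -/
def IsBasisAlong (s : A →+* B) (b : ι → B) : Prop :=
  Function.Bijective fun v : ι → A => ∑ k, s (v k) * b k

/-- `M` is the matrix of the multiplication by `x` in the family `b` over `A`. -/
def IsMulMatrix (s : A →+* B) (b : ι → B) (x : B) (M : Matrix ι ι A) : Prop :=
  ∀ j, x * b j = ∑ k, s (M k j) * b k

lemma coeff_sum_map_mul_C {σ : Type*} (s : A →+* B) (b : ι → B) (v : ι → MvPolynomial σ A)
    (m : σ →₀ ℕ) :
    (∑ k, MvPolynomial.map s (v k) * MvPolynomial.C (b k)).coeff m =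
      ∑ k, s ((v k).coeff m) * b k := by
  simp [MvPolynomial.coeff_sum, mul_comm _ (MvPolynomial.C _), MvPolynomial.coeff_map,
    mul_comm _ (b _)]

namespace IsBasisAlong

variable {s : A →+* B} {b : ι → B}

lemma eq_zero (hb : IsBasisAlong s b) {v : ι → A} (h : ∑ k, s (v k) * b k = 0) (k : ι) :
    v k = 0 := by
  have : v = 0 := hb.1 (by simpa using h)
  simp [this]

lemma ext (hb : IsBasisAlong s b) {v w : ι → A}
    (h : ∑ k, s (v k) * b k = ∑ k, s (w k) * b k) (k : ι) : v k = w k :=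
  congrFun (hb.1 h) k

lemma exists_eq (hb : IsBasisAlong s b) (x : B) : ∃ v : ι → A, x = ∑ k, s (v k) * b k :=
  let ⟨v, hv⟩ := hb.2 x
  ⟨v, hv.symm⟩

/-- The basis of the algebra defined by `s` that underlies a basis along `s`. -/
noncomputable def toBasis (hb : IsBasisAlong s b) :
    let := s.toAlgebra
    Module.Basis ι A B :=
  let := s.toAlgebra
  Module.Basis.mk (v := b)
    (by
      rw [Fintype.linearIndependent_iff]
      intro g hg k
      exact hb.eq_zero (by simpa [Algebra.smul_def, RingHom.algebraMap_toAlgebra] using hg) k)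
    (by
      rintro x -
      obtain ⟨v, rfl⟩ := hb.exists_eq x
      refine Submodule.sum_mem _ fun k _ => ?_
      exact Submodule.smul_mem _ (v k) (Submodule.subset_span ⟨k, rfl⟩))

lemma toBasis_apply (hb : IsBasisAlong s b) (k : ι) :
    let := s.toAlgebra
    hb.toBasis k = b k := by
  simp [toBasis]

lemma exists_isMulMatrix (hb : IsBasisAlong s b) (x : B) : ∃ M, IsMulMatrix s b x M := by
  choose v hv using fun j => hb.exists_eq (x * b j)
  exact ⟨fun k j => v j k, hv⟩

lemma toMatrix_mul_eq [DecidableEq ι] (hb : IsBasisAlong s b) {x : B} {M : Matrix ι ι A}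
    (hM : IsMulMatrix s b x M) :
    let := s.toAlgebra
    LinearMap.toMatrix hb.toBasis hb.toBasis (LinearMap.mulLeft A x) = M := by
  let := s.toAlgebra
  ext k j
  rw [LinearMap.toMatrix_apply, LinearMap.mulLeft_apply, toBasis_apply, hM j]
  have : ∑ k, s (M k j) * b k = ∑ k, M k j • hb.toBasis k := by
    simp [toBasis_apply, Algebra.smul_def, RingHom.algebraMap_toAlgebra]
  rw [this, Module.Basis.repr_sum_self]

lemma charpoly_eq [DecidableEq ι] {b' : ι → B} (hb : IsBasisAlong s b) (hb' : IsBasisAlong s b')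
    {x : B} {M M' : Matrix ι ι A} (hM : IsMulMatrix s b x M) (hM' : IsMulMatrix s b' x M') :
    M.charpoly = M'.charpoly := by
  let := s.toAlgebra
  have := Module.Free.of_basis hb.toBasis
  have := Module.Finite.of_basis hb.toBasis
  rw [← hb.toMatrix_mul_eq hM, ← hb'.toMatrix_mul_eq hM', LinearMap.charpoly_toMatrix,
    LinearMap.charpoly_toMatrix]

/-- The theorem of Cayley and Hamilton. -/
lemma eval₂_charpoly [DecidableEq ι] (hb : IsBasisAlong s b) {x : B} {M : Matrix ι ι A}
    (hM : IsMulMatrix s b x M) : M.charpoly.eval₂ s x = 0 := by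
  let := s.toAlgebra
  have := Module.Free.of_basis hb.toBasis
  have := Module.Finite.of_basis hb.toBasis
  have h := LinearMap.aeval_self_charpoly (LinearMap.mulLeft A x)
  rw [← LinearMap.charpoly_toMatrix _ hb.toBasis, hb.toMatrix_mul_eq hM] at h
  have h' : LinearMap.mulLeft A x = Algebra.lmul A B x := rfl
  rw [h', Polynomial.aeval_algHom_apply] at h
  have := congr($h 1)
  simpa [Polynomial.aeval_def, RingHom.algebraMap_toAlgebra] using this

/-- An element divides its norm. -/
lemma dvd_det [DecidableEq ι] (hb : IsBasisAlong s b) {x : B} {M : Matrix ι ι A}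
    (hM : IsMulMatrix s b x M) : x ∣ s M.det := by
  have h := hb.eval₂_charpoly hM
  rw [← Polynomial.divX_mul_X_add M.charpoly] at h
  simp only [Polynomial.eval₂_add, Polynomial.eval₂_mul, Polynomial.eval₂_X,
    Polynomial.eval₂_C] at h
  rw [Matrix.det_eq_sign_charpoly_coeff, map_mul]
  refine Dvd.dvd.mul_left ?_ _
  rw [eq_neg_of_add_eq_zero_right h]
  exact (dvd_mul_left _ _).neg_right

/-- Membership in an extended ideal is detected by the coordinates. -/
lemma sum_mem_map_iff (hb : IsBasisAlong s b) (I : Ideal A) (v : ι → A) :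
    ∑ k, s (v k) * b k ∈ I.map s ↔ ∀ k, v k ∈ I := by
  refine ⟨fun h => ?_, fun h => Ideal.sum_mem _ fun k _ =>
    Ideal.mul_mem_right _ _ (Ideal.mem_map_of_mem s (h k))⟩
  suffices ∀ x ∈ I.map s, ∃ w : ι → A, (∀ k, w k ∈ I) ∧ x = ∑ k, s (w k) * b k by
    obtain ⟨w, hw, h'⟩ := this _ h
    intro k
    rw [hb.ext h' k]
    exact hw k
  intro x hx
  refine Submodule.span_induction (p := fun x _ => ∃ w : ι → A, (∀ k, w k ∈ I) ∧
    x = ∑ k, s (w k) * b k) ?_ ?_ ?_ ?_ hx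
  · rintro _ ⟨a, ha, rfl⟩
    obtain ⟨v, hv⟩ := hb.exists_eq 1
    refine ⟨fun k => a * v k, fun k => Ideal.mul_mem_right _ _ ha, ?_⟩
    simp only [map_mul, mul_assoc, ← Finset.mul_sum, ← hv, mul_one]
  · exact ⟨0, fun k => by simp, by simp⟩
  · rintro _ _ - - ⟨w, hw, rfl⟩ ⟨w', hw', rfl⟩
    exact ⟨w + w', fun k => add_mem (hw k) (hw' k), by simp [add_mul, Finset.sum_add_distrib]⟩
  · rintro y _ - ⟨w, hw, rfl⟩
    obtain ⟨M, hM⟩ := hb.exists_isMulMatrix y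
    refine ⟨fun k => ∑ j, M k j * w j, fun k => Ideal.sum_mem _ fun j _ =>
      Ideal.mul_mem_left _ _ (hw j), ?_⟩
    have (j : ι) : y * (s (w j) * b j) = s (w j) * ∑ k, s (M k j) * b k := by rw [← hM j]; ring
    simp only [smul_eq_mul, Finset.mul_sum, map_sum, map_mul, Finset.sum_mul, this]
    rw [Finset.sum_comm]
    exact Finset.sum_congr rfl fun k _ => Finset.sum_congr rfl fun j _ => by ring

/-- A basis along `s` remains a basis over polynomial rings. -/
lemma mvPolynomial (hb : IsBasisAlong s b) (σ : Type*) :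
    IsBasisAlong (MvPolynomial.map (σ := σ) s) (fun k => MvPolynomial.C (b k)) := by
  classical
  refine ⟨fun v w h => ?_, fun p => ?_⟩
  · funext k
    ext m
    refine hb.ext (v := fun k => (v k).coeff m) (w := fun k => (w k).coeff m) ?_ k
    rw [← coeff_sum_map_mul_C, ← coeff_sum_map_mul_C]
    exact congrArg _ h
  · choose c hc using fun m => hb.exists_eq (p.coeff m)
    refine ⟨fun k => ∑ m ∈ p.support, MvPolynomial.monomial m (c m k), ?_⟩
    ext m
    refine (coeff_sum_map_mul_C s b _ m).trans ?_
    simp only [MvPolynomial.coeff_sum, MvPolynomial.coeff_monomial, Finset.sum_ite_eq']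
    split_ifs with h
    · exact (hc m).symm
    · simpa using (MvPolynomial.notMem_support_iff.mp h).symm

end IsBasisAlong

/-- The matrix of a multiplication is compatible with base change. -/
lemma IsMulMatrix.map {A' B' : Type*} [CommRing A'] [CommRing B'] {s : A →+* B} {b : ι → B} {x : B}
    {M : Matrix ι ι A} (hM : IsMulMatrix s b x M) {f : A →+* A'} {g : B →+* B'} {s' : A' →+* B'}
    (h : g.comp s = s'.comp f) : IsMulMatrix s' (g ∘ b) (g x) (M.map f) := by
  intro j
  have (a : A) : s' (f a) = g (s a) := (DFunLike.congr_fun h a).symm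
  simp [this, ← map_mul, hM j, ← map_sum]

end IsBasisAlong

/-! ### Polynomials with a unit value -/

/-- A polynomial that takes the value `1` somewhere is not a zero divisor: after a translation its
constant coefficient is `1`, so that it is invertible as a power series. -/
lemma eq_zero_of_mul_eq_zero_of_eval_eq_one {σ F : Type*} [CommRing F] {p q : MvPolynomial σ F}
    (x : σ → F) (hp : p.eval x = 1) (h : p * q = 0) : q = 0 := by
  let τ (y : σ → F) : MvPolynomial σ F →ₐ[F] MvPolynomial σ F :=
    MvPolynomial.aeval fun i => MvPolynomial.X i + MvPolynomial.C (y i)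
  have hτ : (τ (-x)).comp (τ x) = AlgHom.id _ _ := by
    ext i
    simp [τ]
  have hinj : Function.Injective (τ x) := fun a b hab => by
    have := congr(τ (-x) $hab)
    simpa [← AlgHom.comp_apply, hτ] using this
  have hcoeff : (τ x p).coeff 0 = 1 := by
    rw [← MvPolynomial.constantCoeff_eq, ← hp]
    suffices (MvPolynomial.constantCoeff.comp (τ x).toRingHom) = MvPolynomial.eval x from
      DFunLike.congr_fun this p
    ext i <;> simp [τ]
  have hunit : IsUnit ((τ x p : MvPolynomial σ F) : MvPowerSeries σ F) := by
    rw [MvPowerSeries.isUnit_iff_constantCoeff, ← MvPowerSeries.coeff_zero_eq_constantCoeff_apply,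
      MvPolynomial.coeff_coe, hcoeff]
    exact isUnit_one
  apply hinj
  rw [map_zero]
  apply MvPolynomial.coe_injective
  refine hunit.mul_left_cancel ?_
  rw [← MvPolynomial.coe_mul, ← map_mul, h]
  simp

/-! ### Quotients of affine schemes: the algebra -/

lemma mvPolynomial_map_comp_map {σ R₁ R₂ R₃ : Type*} [CommRing R₁] [CommRing R₂]
    [CommRing R₃] (f : R₁ →+* R₂) (g : R₂ →+* R₃) :
    (MvPolynomial.map (σ := σ) g).comp (MvPolynomial.map f) = MvPolynomial.map (g.comp f) :=
  RingHom.ext fun p => MvPolynomial.map_map f g p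

section Cogroupoid

variable {A B D ι : Type*} [CommRing A] [CommRing B] [CommRing D] [Fintype ι]

/-- The rings of functions of an affine finite free equivalence relation: `A`, `B` and `D` are the
functions on the points `x`, on the pairs `x ∼ y` and on the triples `x ∼ y ∼ z`. The maps `s`, `t`
are the pullbacks along `(x, y) ↦ x` and `(x, y) ↦ y`, the map `ε` is the restriction to the
diagonal and `d₁₂`, `d₁₃`, `d₂₃` are the pullbacks along the projections from triples to pairs. The
family `b` is a basis of `B` over `A` through `s`; the triples are in two ways a base change of the
first projection from pairs to points, and this gives two bases of `D` over `B` through `d₁₂`. -/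
structure IsCogroupoid (s t : A →+* B) (ε : B →+* A) (d₁₂ d₁₃ d₂₃ : B →+* D) (b : ι → B) :
    Prop where
  ε_s : ε.comp s = RingHom.id A
  ε_t : ε.comp t = RingHom.id A
  d₁₂_s : d₁₂.comp s = d₁₃.comp s
  d₁₂_t : d₁₂.comp t = d₂₃.comp s
  d₁₃_t : d₁₃.comp t = d₂₃.comp t
  basis : IsBasisAlong s b
  basis₁₃ : IsBasisAlong d₁₂ (d₁₃ ∘ b)
  basis₂₃ : IsBasisAlong d₁₂ (d₂₃ ∘ b)

namespace IsCogroupoid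

variable {s t : A →+* B} {ε : B →+* A} {d₁₂ d₁₃ d₂₃ : B →+* D} {b : ι → B}

lemma mvPolynomial (h : IsCogroupoid s t ε d₁₂ d₁₃ d₂₃ b) (σ : Type*) :
    IsCogroupoid (MvPolynomial.map (σ := σ) s) (MvPolynomial.map t) (MvPolynomial.map ε)
      (MvPolynomial.map d₁₂) (MvPolynomial.map d₁₃) (MvPolynomial.map d₂₃)
      (fun k => MvPolynomial.C (b k)) where
  ε_s := by rw [mvPolynomial_map_comp_map, h.ε_s]; exact RingHom.ext MvPolynomial.map_id
  ε_t := by rw [mvPolynomial_map_comp_map, h.ε_t]; exact RingHom.ext MvPolynomial.map_id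
  d₁₂_s := by simp only [mvPolynomial_map_comp_map, h.d₁₂_s]
  d₁₂_t := by simp only [mvPolynomial_map_comp_map, h.d₁₂_t]
  d₁₃_t := by simp only [mvPolynomial_map_comp_map, h.d₁₃_t]
  basis := h.basis.mvPolynomial σ
  basis₁₃ := by
    convert h.basis₁₃.mvPolynomial σ using 2
    simp
  basis₂₃ := by
    convert h.basis₂₃.mvPolynomial σ using 2
    simp

/-- The characteristic polynomial of `t a` over `A` is invariant: both of its pullbacks to `B` are
the characteristic polynomial of the function `(x, y, z) ↦ a z` over the pairs `(x, y)`. -/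
lemma map_charpoly [DecidableEq ι] (h : IsCogroupoid s t ε d₁₂ d₁₃ d₂₃ b) {a : A}
    {M : Matrix ι ι A} (hM : IsMulMatrix s b (t a) M) :
    M.charpoly.map s = M.charpoly.map t := by
  have h₁ := hM.map h.d₁₂_s.symm
  have h₂ := hM.map h.d₁₂_t.symm
  rw [← RingHom.comp_apply, ← h.d₁₃_t, RingHom.comp_apply] at h₂
  rw [← Matrix.charpoly_map, ← Matrix.charpoly_map]
  exact h.basis₁₃.charpoly_eq h.basis₂₃ h₁ h₂

lemma map_det [DecidableEq ι] (h : IsCogroupoid s t ε d₁₂ d₁₃ d₂₃ b) {a : A}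
    {M : Matrix ι ι A} (hM : IsMulMatrix s b (t a) M) : s M.det = t M.det := by
  have := congr(Polynomial.coeff $(h.map_charpoly hM) 0)
  rw [Polynomial.coeff_map, Polynomial.coeff_map] at this
  rw [Matrix.det_eq_sign_charpoly_coeff]
  simp [this]

lemma t_injective (h : IsCogroupoid s t ε d₁₂ d₁₃ d₂₃ b) : Function.Injective t :=
  Function.LeftInverse.injective (g := ε) fun a => DFunLike.congr_fun h.ε_t a

/-- By the theorem of Cayley and Hamilton, `A` is integral over the invariant functions. -/
lemma isIntegral (h : IsCogroupoid s t ε d₁₂ d₁₃ d₂₃ b) :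
    Algebra.IsIntegral (s.eqLocus t) A := by
  classical
  refine ⟨fun a => ?_⟩
  obtain ⟨M, hM⟩ := h.basis.exists_isMulMatrix (t a)
  have hlift : M.charpoly ∈ Polynomial.lifts (algebraMap (s.eqLocus t) A) := by
    rw [Polynomial.lifts_iff_coeff_lifts]
    intro n
    have := congr(Polynomial.coeff $(h.map_charpoly hM) n)
    rw [Polynomial.coeff_map, Polynomial.coeff_map] at this
    exact ⟨⟨_, this⟩, rfl⟩
  obtain ⟨q, hq, -, hmonic⟩ := Polynomial.lifts_and_natDegree_eq_and_monic hlift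
    M.charpoly_monic
  refine ⟨q, hmonic, h.t_injective ?_⟩
  rw [map_zero, ← h.basis.eval₂_charpoly hM, ← hq, Polynomial.hom_eval₂, Polynomial.eval₂_map]
  congr 1
  ext c
  exact c.2.symm

/-- The norm of a polynomial `p` that takes the value `1` does not vanish modulo any prime: otherwise
the multiplication by `p` would have a kernel over the residue ring of the prime. -/
lemma exists_coeff_det_notMem [DecidableEq ι] {σ : Type*} (hb : IsBasisAlong s b)
    {p : MvPolynomial σ B} (x : σ → B) (hp : p.eval x = 1) {M : Matrix ι ι (MvPolynomial σ A)}
    (hM : IsMulMatrix (MvPolynomial.map s) (fun k => MvPolynomial.C (b k)) p M)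
    (n : Ideal A) [n.IsPrime] : ∃ m, M.det.coeff m ∉ n := by
  by_contra! hmem
  have hdet : (M.map (MvPolynomial.map (Ideal.Quotient.mk n))).det = 0 := by
    have : MvPolynomial.map (Ideal.Quotient.mk n) M.det = 0 := by
      ext m
      rw [MvPolynomial.coeff_map, MvPolynomial.coeff_zero, Ideal.Quotient.eq_zero_iff_mem]
      exact hmem m
    rw [← this]
    exact (RingHom.map_det _ _).symm
  obtain ⟨v, hv, hMv⟩ := Matrix.exists_mulVec_eq_zero_iff.mpr hdet
  have hsurj := MvPolynomial.map_surjective (σ := σ) _ (Ideal.Quotient.mk_surjective (I := n))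
  choose w hw using fun k => hsurj (v k)
  have hMw (k : ι) (m : σ →₀ ℕ) : (∑ j, M k j * w j).coeff m ∈ n := by
    have := congrFun hMv k
    simp only [Matrix.mulVec, dotProduct, Matrix.map_apply, ← hw, ← map_mul, ← map_sum,
      Pi.zero_apply] at this
    rw [← Ideal.Quotient.eq_zero_iff_mem, ← MvPolynomial.coeff_map, this]
    simp
  -- The lifted kernel vector is the coordinate vector of a polynomial that is killed by `p` modulo
  -- the ideal generated by `n`.
  set q : MvPolynomial σ B := ∑ k, MvPolynomial.map s (w k) * MvPolynomial.C (b k) with hq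
  have hpq : p * q = ∑ k, MvPolynomial.map s (∑ j, M k j * w j) * MvPolynomial.C (b k) := by
    have (j : ι) : p * (MvPolynomial.map s (w j) * MvPolynomial.C (b j)) =
        MvPolynomial.map s (w j) *
          ∑ k, MvPolynomial.map s (M k j) * MvPolynomial.C (b k) := by
      rw [← hM j]; ring
    simp only [hq, Finset.mul_sum, map_sum, map_mul, Finset.sum_mul, this]
    rw [Finset.sum_comm]
    exact Finset.sum_congr rfl fun k _ => Finset.sum_congr rfl fun j _ => by ring
  let φ := Ideal.Quotient.mk (n.map s)
  have hq0 : MvPolynomial.map φ q = 0 := by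
    refine eq_zero_of_mul_eq_zero_of_eval_eq_one (p := MvPolynomial.map φ p) (φ ∘ x) ?_ ?_
    · have := MvPolynomial.map_eval φ x p
      rw [hp, map_one] at this
      exact this.symm
    · rw [← map_mul, hpq]
      ext m
      rw [MvPolynomial.coeff_map, coeff_sum_map_mul_C, MvPolynomial.coeff_zero,
        Ideal.Quotient.eq_zero_iff_mem]
      exact (hb.sum_mem_map_iff n _).mpr fun k => hMw k m
  apply hv
  funext k
  rw [← hw, Pi.zero_apply]
  ext m
  have : q.coeff m ∈ n.map s := by
    rw [← Ideal.Quotient.eq_zero_iff_mem, ← MvPolynomial.coeff_map, hq0, MvPolynomial.coeff_zero]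
  rw [hq, coeff_sum_map_mul_C, hb.sum_mem_map_iff] at this
  rw [MvPolynomial.coeff_map, MvPolynomial.coeff_zero, Ideal.Quotient.eq_zero_iff_mem]
  exact this k

/-- The pairs are generated over the points by finitely many functions `(x, y) ↦ g y`, and the
coefficients can be chosen linearly and so that they are invariant for a function of `y`.

To see this, consider generic linear combinations `α i` of the functions `g j`, one for each
element of the basis `b`. Over a polynomial ring in the coefficients of these combinations the
determinant `δ` of the functions `t (α i)` in the basis `b` divides an invariant polynomial `N`,
namely its norm. By Cramer's rule, `N` times a function of pairs is a combination of the `t (α i)`,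
and it remains to compare coefficients, as those of `N` generate the unit ideal. -/
lemma exists_dual [DecidableEq ι] {J : Type*} [Fintype J]
    (h : IsCogroupoid s t ε d₁₂ d₁₃ d₂₃ b) (g : J → A) (L : ι → J → A)
    (hL : ∀ k, b k = ∑ j, s (L k j) * t (g j)) :
    ∃ Φ : J → B → A, (∀ j x y, Φ j (x + y) = Φ j x + Φ j y) ∧
      (∀ j a x, Φ j (s a * x) = a * Φ j x) ∧ (∀ x, x = ∑ j, s (Φ j x) * t (g j)) ∧
      ∀ j a, s (Φ j (t a)) = t (Φ j (t a)) := by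
  let σ := ι × J
  have h' := h.mvPolynomial σ
  set S : MvPolynomial σ A →+* MvPolynomial σ B := MvPolynomial.map s with hS
  set T : MvPolynomial σ A →+* MvPolynomial σ B := MvPolynomial.map t with hT
  set β : ι → MvPolynomial σ B := fun k => MvPolynomial.C (b k) with hβ
  choose c hc using h.basis.exists_eq
  have c_add (x y : B) (k : ι) : c (x + y) k = c x k + c y k := by
    refine h.basis.ext (w := fun k => c x k + c y k) ?_ k
    simp only [map_add, add_mul, Finset.sum_add_distrib, ← hc]
  have c_smul (a : A) (x : B) (k : ι) : c (s a * x) k = a * c x k := by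
    refine h.basis.ext (w := fun k => a * c x k) ?_ k
    simp only [map_mul, mul_assoc, ← Finset.mul_sum, ← hc]
  -- The row `i` of `P` consists of the coordinates of `t (α i)`.
  let P : Matrix ι ι (MvPolynomial σ A) := fun i k =>
    ∑ j, MvPolynomial.X (i, j) * MvPolynomial.C (c (t (g j)) k)
  let α : ι → MvPolynomial σ A := fun i => ∑ j, MvPolynomial.X (i, j) * MvPolynomial.C (g j)
  have hα (i : ι) : T (α i) = ∑ k, S (P i k) * β k := by
    have (j : J) : (MvPolynomial.C (t (g j)) : MvPolynomial σ B) =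
        ∑ k, MvPolynomial.C (s (c (t (g j)) k)) * β k := by
      conv_lhs => rw [hc (t (g j))]
      simp [hβ]
    simp only [α, P, map_sum, map_mul, hS, hT, MvPolynomial.map_X, MvPolynomial.map_C, this,
      Finset.sum_mul, Finset.mul_sum]
    rw [Finset.sum_comm]
    simp only [mul_assoc]
  -- At the coefficients `L` the combinations become the basis `b`, so `P` becomes the identity.
  let l : σ → A := fun ij => L ij.1 ij.2
  have hδ : MvPolynomial.eval l P.det = 1 := by
    rw [RingHom.map_det, ← Matrix.det_one (n := ι)]
    congr 1
    ext i k
    have hP (k : ι) : MvPolynomial.eval l (P i k) = ∑ j, L i j * c (t (g j)) k := by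
      simp [P, l]
    refine h.basis.ext (v := fun k => MvPolynomial.eval l (P i k))
      (w := fun k => (1 : Matrix ι ι A) i k) ?_ k
    simp only [Matrix.one_apply, hP, map_sum, map_mul, Finset.sum_mul]
    rw [Finset.sum_comm]
    simp only [mul_assoc, ← Finset.mul_sum, ← hc, ← hL]
    simp
  have eval_map {F : Type _} [CommRing F] (f : A →+* F) :
      MvPolynomial.eval (f ∘ l) (MvPolynomial.map f P.det) = 1 := by
    have := MvPolynomial.map_eval f l P.det
    rw [hδ, map_one] at this
    exact this.symm
  obtain ⟨M, hM⟩ := h'.basis.exists_isMulMatrix (T P.det)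
  have hN : S M.det = T M.det := h'.map_det hM
  obtain ⟨ν, hν⟩ : P.det ∣ M.det := by
    have := map_dvd (MvPolynomial.map ε) (h'.basis.dvd_det hM)
    rwa [← RingHom.comp_apply, ← RingHom.comp_apply, h'.ε_s, h'.ε_t] at this
  -- The coefficients of `N * x` in the `t (α i)`, from Cramer's rule and `N = δ * ν`.
  let Y : ι → B → MvPolynomial σ A := fun i x =>
    ν * ∑ k, MvPolynomial.C (c x k) * P.adjugate k i
  have Y_add (i : ι) (x y : B) : Y i (x + y) = Y i x + Y i y := by
    simp only [Y, c_add, map_add, add_mul, Finset.sum_add_distrib, mul_add]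
  have Y_smul (i : ι) (a : A) (x : B) : Y i (s a * x) = MvPolynomial.C a * Y i x := by
    simp only [Y, c_smul, map_mul, Finset.mul_sum]
    exact Finset.sum_congr rfl fun k _ => by ring
  have hY (x : B) : S M.det * MvPolynomial.C x = ∑ i, S (Y i x) * T (α i) := by
    have hadj (k m : ι) : ∑ i, P.adjugate k i * P i m = if k = m then P.det else 0 := by
      have := congrFun (congrFun P.adjugate_mul k) m
      rw [Matrix.mul_apply] at this
      rw [this]
      simp [Matrix.one_apply]
    have key (m : ι) : ∑ i, Y i x * P i m = M.det * MvPolynomial.C (c x m) := by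
      have (i : ι) : Y i x * P i m =
          ∑ k, ν * MvPolynomial.C (c x k) * (P.adjugate k i * P i m) := by
        simp only [Y, Finset.mul_sum, Finset.sum_mul]
        exact Finset.sum_congr rfl fun k _ => by ring
      simp only [this]
      rw [Finset.sum_comm]
      simp only [← Finset.mul_sum, hadj, mul_ite, mul_zero, Finset.sum_ite_eq', Finset.mem_univ,
        if_true, hν]
      ring
    calc S M.det * MvPolynomial.C x
        = ∑ m, S (M.det * MvPolynomial.C (c x m)) * β m := by
          conv_lhs => rw [hc x]
          simp only [map_sum, map_mul, Finset.mul_sum, hS, hβ, MvPolynomial.map_C, mul_assoc]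
      _ = ∑ i, S (Y i x) * T (α i) := by
          simp only [hα, ← key, map_sum, map_mul, Finset.sum_mul, Finset.mul_sum, mul_assoc]
          rw [Finset.sum_comm]
  -- For a function `(x, y) ↦ a y`, pull the equation `hY` back to triples along `(x, z)` and `(y, z)`.
  -- The two left hand sides agree, so the coefficients `Y i (t a)` at `x` and at `y` agree as well,
  -- because the functions `α i` of `z` are linearly independent.
  have hYt (i : ι) (a : A) : S (Y i (t a)) = T (Y i (t a)) := by
    have e₁ := congr(MvPolynomial.map d₁₃ $(hY (t a)))
    have e₂ := congr(MvPolynomial.map d₂₃ $(hY (t a)))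
    simp only [map_mul, map_sum, MvPolynomial.map_C] at e₁ e₂
    simp only [← RingHom.comp_apply, ← h'.d₁₂_s, ← h'.d₁₂_t, h.d₁₃_t, h'.d₁₃_t] at e₁ e₂
    rw [RingHom.comp_apply, hN, ← RingHom.comp_apply, e₂] at e₁
    have e₃ : ∑ k, MvPolynomial.map d₁₂ (∑ i, (S (Y i (t a)) - T (Y i (t a))) * S (P i k)) *
        MvPolynomial.map d₁₃ (β k) = 0 := by
      have hα' (i : ι) : (MvPolynomial.map d₂₃).comp T (α i) =
          ∑ k, MvPolynomial.map d₁₂ (S (P i k)) * MvPolynomial.map d₁₃ (β k) := by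
        rw [← h'.d₁₃_t, RingHom.comp_apply, hα, map_sum]
        simp only [map_mul, ← RingHom.comp_apply, h'.d₁₂_s]
      calc _ = ∑ i, (MvPolynomial.map d₁₂).comp S (Y i (t a)) * (MvPolynomial.map d₂₃).comp T (α i)
            - ∑ i, (MvPolynomial.map d₁₂).comp T (Y i (t a)) *
              (MvPolynomial.map d₂₃).comp T (α i) := by
            simp only [hα', ← Finset.sum_sub_distrib, ← sub_mul, RingHom.comp_apply, Finset.mul_sum,
              map_sum, map_mul, map_sub, Finset.sum_mul]
            rw [Finset.sum_comm]
            simp only [mul_assoc]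
        _ = 0 := by rw [e₁, sub_self]
    have e₄ := fun k => h'.basis₁₃.eq_zero e₃ k
    have e₅ : Matrix.vecMul (fun i => S (Y i (t a)) - T (Y i (t a))) (P.map S) = 0 := by
      funext k
      simpa [Matrix.vecMul, dotProduct] using e₄ k
    have e₆ := congr(Matrix.vecMul $e₅ (P.map S).adjugate i)
    rw [Matrix.vecMul_vecMul, Matrix.mul_adjugate, Matrix.zero_vecMul, Matrix.vecMul_smul,
      Matrix.vecMul_one, Pi.smul_apply, smul_eq_mul, Pi.zero_apply,
      show (P.map S).det = S P.det from (RingHom.map_det _ _).symm] at e₆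
    exact sub_eq_zero.mp (eq_zero_of_mul_eq_zero_of_eval_eq_one _ (eval_map s) e₆)
  -- The coefficients of `N` generate the unit ideal of the ring of invariants: a maximal ideal that
  -- contains them would be the contraction of a prime of `A`, as `A` is integral.
  let N' : (σ →₀ ℕ) → s.eqLocus t := fun m => ⟨M.det.coeff m, by
    have := congr(MvPolynomial.coeff m $hN)
    rwa [hS, hT, MvPolynomial.coeff_map, MvPolynomial.coeff_map] at this⟩
  have hspan : Ideal.span (Set.range N') = ⊤ := by
    by_contra hne
    obtain ⟨p, hp, hle⟩ := Ideal.exists_le_maximal _ hne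
    have := h.isIntegral
    obtain ⟨n, -, hn, hnp⟩ := Ideal.exists_ideal_over_prime_of_isIntegral (S := A) p ⊥ (by
      rw [← RingHom.ker_eq_comap_bot]
      exact ((RingHom.injective_iff_ker_eq_bot _).mp Subtype.val_injective).le.trans bot_le)
    obtain ⟨m, hm⟩ := exists_coeff_det_notMem h.basis _ (eval_map t) hM n
    apply hm
    have : N' m ∈ n.comap (algebraMap (s.eqLocus t) A) := by
      rw [hnp]
      exact hle (Ideal.subset_span ⟨m, rfl⟩)
    exact this
  obtain ⟨w, hw⟩ : ∃ w : (σ →₀ ℕ) →₀ s.eqLocus t, ∑ m ∈ w.support, w m * N' m = 1 := by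
    have : (1 : s.eqLocus t) ∈ Ideal.span (Set.range N') := hspan ▸ Submodule.mem_top
    obtain ⟨w, hw⟩ := (Finsupp.mem_ideal_span_range_iff_exists_finsupp).mp this
    exact ⟨w, hw⟩
  refine ⟨fun j x => ∑ m ∈ w.support, (w m : A) *
    (∑ i, MvPolynomial.X (i, j) * Y i x).coeff m, ?_, ?_, ?_, ?_⟩
  · intro j x y
    simp only [Y_add, mul_add, Finset.sum_add_distrib, MvPolynomial.coeff_add]
  · intro j a x
    simp only [Y_smul, mul_left_comm _ (MvPolynomial.C a), ← Finset.mul_sum,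
      MvPolynomial.coeff_C_mul, mul_left_comm _ a]
  · intro x
    have hx (m : σ →₀ ℕ) : s (M.det.coeff m) * x =
        ∑ j, s ((∑ i, MvPolynomial.X (i, j) * Y i x).coeff m) * t (g j) := by
      rw [← coeff_sum_map_mul_C s (fun j => t (g j))
        (fun j => ∑ i, MvPolynomial.X (i, j) * Y i x) m, mul_comm, ← MvPolynomial.coeff_map,
        ← MvPolynomial.coeff_C_mul, mul_comm, ← hS, hY]
      congr 1
      simp only [α, hT, hS, map_sum, map_mul, MvPolynomial.map_X, MvPolynomial.map_C,
        Finset.mul_sum, Finset.sum_mul]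
      rw [Finset.sum_comm]
      exact Finset.sum_congr rfl fun _ _ => Finset.sum_congr rfl fun _ _ => by ring
    have h₁ : ∑ m ∈ w.support, s (w m) * (s (M.det.coeff m) * x) = x := by
      have := congr(s ($hw : A))
      simp only [← mul_assoc, ← Finset.sum_mul, ← map_mul, ← map_sum]
      simp only [AddSubmonoidClass.coe_finsetSum, Subring.coe_mul, Subring.coe_one, map_one, N']
        at this
      rw [this, one_mul]
    conv_lhs => rw [← h₁]
    simp only [hx, map_sum, map_mul, Finset.mul_sum, Finset.sum_mul, mul_assoc]
    rw [Finset.sum_comm]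
  · intro j a
    simp only [map_sum, map_mul, show ∀ m, s (w m) = t (w m) from fun m => (w m).2,
      ← MvPolynomial.coeff_map s, ← MvPolynomial.coeff_map t]
    simp only [← hS, ← hT, hYt]
    simp [hS, hT]

/-- The coordinates of `exists_dual` for generators `g j` indexed by some `Fin n`. Their restriction
to the diagonal expresses the elements of `A` in terms of the `g j` with invariant coefficients. -/
lemma exists_generators (h : IsCogroupoid s t ε d₁₂ d₁₃ d₂₃ b)
    (hgen : ∀ x, ∃ (n : ℕ) (a a' : Fin n → A), x = ∑ i, s (a i) * t (a' i)) :
    ∃ (n : ℕ) (g : Fin n → A) (Φ : Fin n → B → A), (∀ j x y, Φ j (x + y) = Φ j x + Φ j y) ∧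
      (∀ j a x, Φ j (s a * x) = a * Φ j x) ∧ (∀ x, x = ∑ j, s (Φ j x) * t (g j)) ∧
      (∀ j a, Φ j (t a) ∈ s.eqLocus t) ∧ ∀ a, a = ∑ j, Φ j (t a) * g j := by
  classical
  choose n a a' ha using fun k => hgen (b k)
  let J := Σ k, Fin (n k)
  obtain ⟨Φ, h₁, h₂, h₃, h₄⟩ := h.exists_dual (J := J) (fun j => a' j.1 j.2)
    (fun k j => if j.1 = k then a j.1 j.2 else 0) (fun k => by
      rw [Fintype.sum_sigma, Finset.sum_eq_single k]
      · simp [← ha]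
      · intro k' _ hk'
        simp [hk']
      · simp)
  let e := Fintype.equivFin J
  have h₃' (x : B) : x = ∑ i, s (Φ (e.symm i) x) * t (a' (e.symm i).1 (e.symm i).2) := by
    conv_lhs => rw [h₃ x]
    exact (e.symm.sum_comp fun j => s (Φ j x) * t (a' j.1 j.2)).symm
  refine ⟨_, fun i => a' (e.symm i).1 (e.symm i).2, fun i => Φ (e.symm i), fun i => h₁ _,
    fun i => h₂ _, h₃', fun i => h₄ _, fun a => ?_⟩
  have := congr(ε $(h₃' (t a)))
  simp only [map_sum, map_mul, ← RingHom.comp_apply, h.ε_s, h.ε_t] at this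
  simpa using this

/-- The algebra `A` is finite projective over the ring of invariants: the functionals of
`exists_dual` provide a dual basis. -/
lemma finite_and_projective (h : IsCogroupoid s t ε d₁₂ d₁₃ d₂₃ b)
    (hgen : ∀ x, ∃ (n : ℕ) (a a' : Fin n → A), x = ∑ i, s (a i) * t (a' i)) :
    Module.Finite (s.eqLocus t) A ∧ Module.Projective (s.eqLocus t) A := by
  obtain ⟨n, g, Φ, h₁, h₂, -, h₄, h₅⟩ := h.exists_generators hgen
  let p : (Fin n → s.eqLocus t) →ₗ[s.eqLocus t] A := Fintype.linearCombination _ g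
  let i : A →ₗ[s.eqLocus t] (Fin n → s.eqLocus t) :=
    { toFun a j := ⟨Φ j (t a), h₄ j a⟩
      map_add' a a' := by
        funext j
        ext
        simp [h₁]
      map_smul' c a := by
        funext j
        ext
        have : t (c • a) = s c * t a := by
          rw [Subring.smul_def, smul_eq_mul, map_mul, show t (c : A) = s c from c.2.symm]
        simp [this, h₂] }
  have hpi : p ∘ₗ i = LinearMap.id := by
    ext a
    simpa [p, i, Fintype.linearCombination_apply, Subring.smul_def] using (h₅ a).symm
  exact ⟨.of_surjective p (LinearMap.surjective_of_comp_eq_id _ _ hpi), .of_split i p hpi⟩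

/-- The ring of pairs is the tensor square of `A` over the ring of invariants. -/
lemma exists_lift (h : IsCogroupoid s t ε d₁₂ d₁₃ d₂₃ b)
    (hgen : ∀ x, ∃ (n : ℕ) (a a' : Fin n → A), x = ∑ i, s (a i) * t (a' i))
    {Z : Type*} [CommRing Z] (f f' : A →+* Z) (hf : ∀ a, s a = t a → f a = f' a) :
    ∃ k : B →+* Z, k.comp s = f ∧ k.comp t = f' := by
  obtain ⟨n, g, Φ, h₁, h₂, h₃, h₄, h₅⟩ := h.exists_generators hgen
  let k₀ : B →+ Z := AddMonoidHom.mk' (fun x => ∑ j, f (Φ j x) * f' (g j)) fun x y => by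
    simp only [h₁, map_add, add_mul, Finset.sum_add_distrib]
  have key (a a' : A) : k₀ (s a * t a') = f a * f' a' := by
    conv_rhs => rw [h₅ a']
    simp only [k₀, AddMonoidHom.mk'_apply, h₂, map_mul, map_sum, Finset.mul_sum, mul_assoc]
    exact Finset.sum_congr rfl fun j _ => by rw [hf _ (h₄ j a')]
  have hone : k₀ 1 = 1 := by simpa using key 1 1
  have hmul (x y : B) : k₀ (x * y) = k₀ x * k₀ y := by
    rw [h₃ x, h₃ y]
    simp only [Finset.sum_mul_sum, map_sum, key]
    refine Finset.sum_congr rfl fun i _ => Finset.sum_congr rfl fun j _ => ?_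
    rw [mul_mul_mul_comm, ← map_mul, ← map_mul, key, map_mul, map_mul]
    ring
  refine ⟨{ k₀ with map_one' := hone, map_mul' := hmul, map_zero' := k₀.map_zero },
    RingHom.ext fun a => ?_, RingHom.ext fun a => ?_⟩
  · simpa using key a 1
  · simpa using key 1 a

lemma isPushout {A B D : CommRingCat.{u}} {s t : A ⟶ B} {ε : B ⟶ A} {d₁₂ d₁₃ d₂₃ : B ⟶ D}
    {b : ι → B} (h : IsCogroupoid s.hom t.hom ε.hom d₁₂.hom d₁₃.hom d₂₃.hom b)
    (hgen : ∀ x, ∃ (n : ℕ) (a a' : Fin n → A), x = ∑ i, s (a i) * t (a' i)) :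
    IsPushout (CommRingCat.ofHom (s.hom.eqLocus t.hom).subtype)
      (CommRingCat.ofHom (s.hom.eqLocus t.hom).subtype) s t := by
  have w : CommRingCat.ofHom (s.hom.eqLocus t.hom).subtype ≫ s =
      CommRingCat.ofHom (s.hom.eqLocus t.hom).subtype ≫ t := by
    ext x
    exact x.2
  have hlift (c : PushoutCocone (CommRingCat.ofHom (s.hom.eqLocus t.hom).subtype)
      (CommRingCat.ofHom (s.hom.eqLocus t.hom).subtype)) :=
    h.exists_lift hgen c.inl.hom c.inr.hom fun a ha =>
      DFunLike.congr_fun (congrArg CommRingCat.Hom.hom c.condition) ⟨a, ha⟩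
  choose k hk using hlift
  refine ⟨⟨w⟩, ⟨PushoutCocone.IsColimit.mk w (fun c => CommRingCat.ofHom (k c))
    (fun c => CommRingCat.hom_ext (hk c).1) (fun c => CommRingCat.hom_ext (hk c).2) ?_⟩⟩
  intro c m h₁ h₂
  ext x
  obtain ⟨n, a, a', rfl⟩ := hgen x
  simp only [map_sum, map_mul]
  refine Finset.sum_congr rfl fun i _ => ?_
  have e₁ (a : A) : m (s a) = k c (s a) :=
    (congr($h₁ a)).trans (DFunLike.congr_fun (hk c).1 a).symm
  have e₂ (a : A) : m (t a) = k c (t a) :=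
    (congr($h₂ a)).trans (DFunLike.congr_fun (hk c).2 a).symm
  rw [e₁, e₂]
  rfl

end IsCogroupoid

end Cogroupoid

/-! ### Equivalence relations in terms of points with values in a test object -/

section Relation

variable {C : Type w} [Category.{v} C] {R X Q : C}

/-- The pair `p₁, p₂ : R ⟶ X` is an equivalence relation on points with values in any test
object. -/
structure IsRelation (p₁ p₂ : R ⟶ X) : Prop where
  hom_ext : ∀ {T : C} (f g : T ⟶ R), f ≫ p₁ = g ≫ p₁ → f ≫ p₂ = g ≫ p₂ → f = g
  equivalence : ∀ T : C, Equivalence (Related p₁ p₂ T)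

variable {p₁ p₂ : R ⟶ X}

/-- The projections `(x, y, z) ↦ (x, y)` and `(x, y, z) ↦ (x, z)` from the triples of related points
are again a base change of the first projection along itself. -/
lemma IsRelation.isPullback (h : IsRelation p₁ p₂) {D : C} {q₁₂ q₁₃ q₂₃ : D ⟶ R}
    (hD : IsPullback q₁₂ q₂₃ p₂ p₁) (h₁ : q₁₃ ≫ p₁ = q₁₂ ≫ p₁) (h₂ : q₁₃ ≫ p₂ = q₂₃ ≫ p₂) :
    IsPullback q₁₂ q₁₃ p₁ p₁ := by
  have hlift (c : PullbackCone p₁ p₁) : ∃ k : c.pt ⟶ D, k ≫ q₁₂ = c.fst ∧ k ≫ q₁₃ = c.snd := by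
    obtain ⟨w, hw₁, hw₂⟩ := (h.equivalence c.pt).trans
      ((h.equivalence c.pt).symm ⟨c.fst, rfl, rfl⟩) ⟨c.snd, c.condition.symm, rfl⟩
    refine ⟨hD.lift c.fst w hw₁.symm, hD.lift_fst _ _ _, h.hom_ext _ _ ?_ ?_⟩
    · rw [Category.assoc, h₁, hD.lift_fst_assoc, c.condition]
    · rw [Category.assoc, h₂, hD.lift_snd_assoc, hw₂]
  choose k hk using hlift
  refine ⟨⟨h₁.symm⟩, ⟨PullbackCone.IsLimit.mk _ k (fun c => (hk c).1) (fun c => (hk c).2) ?_⟩⟩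
  intro c m hm₁ hm₂
  refine hD.hom_ext (hm₁.trans (hk c).1.symm) (h.hom_ext _ _ ?_ ?_)
  · rw [Category.assoc, Category.assoc, ← hD.w, reassoc_of% hm₁, reassoc_of% (hk c).1]
  · rw [Category.assoc, Category.assoc, ← h₂, reassoc_of% hm₂, reassoc_of% (hk c).2]

/-- An equivalence relation restricts along a monomorphism. -/
lemma IsRelation.restrict (h : IsRelation p₁ p₂) {R' X' : C} {p₁' p₂' : R' ⟶ X'} (i : R' ⟶ R)
    (j : X' ⟶ X) [Mono i]
    (h₁ : p₁' ≫ j = i ≫ p₁) (h₂ : p₂' ≫ j = i ≫ p₂)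
    (hrel : ∀ T (a b : T ⟶ X'), Related p₁' p₂' T a b ↔ Related p₁ p₂ T (a ≫ j) (b ≫ j)) :
    IsRelation p₁' p₂' where
  hom_ext f g hf hg := by
    rw [← cancel_mono i]
    refine h.hom_ext _ _ ?_ ?_
    · rw [Category.assoc, Category.assoc, ← h₁, reassoc_of% hf]
    · rw [Category.assoc, Category.assoc, ← h₂, reassoc_of% hg]
  equivalence T := by
    have := (h.equivalence T).comap fun a : T ⟶ X' => a ≫ j
    convert this using 1
    funext a b
    exact propext (hrel T a b)

end Relation

lemma Related.over {S : Scheme.{u}} {R X T : Over S} {p₁ p₂ : R ⟶ X} {a b : T ⟶ X} :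
    Related p₁ p₂ T a b ↔ Related p₁.left p₂.left T.left a.left b.left := by
  refine ⟨fun ⟨r, h₁, h₂⟩ => ⟨r.left, congr(($h₁).left), congr(($h₂).left)⟩, fun ⟨r, h₁, h₂⟩ => ?_⟩
  refine ⟨Over.homMk r ?_, Over.OverMorphism.ext h₁, Over.OverMorphism.ext h₂⟩
  rw [← Over.w p₁, reassoc_of% h₁, Over.w]

/-- An equivalence relation of `S`-schemes is an equivalence relation of schemes. -/
lemma isRelation_left {S : Scheme.{u}} {R X : Over S} {p₁ p₂ : R ⟶ X}
    (hR : IsEquivalenceRelation p₁ p₂) : IsRelation p₁.left p₂.left := by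
  obtain ⟨e⟩ := hR.nonempty_equivalenceRelation
  have w₁ : p₁.left ≫ X.hom = R.hom := Over.w p₁
  have w₂ : p₂.left ≫ X.hom = R.hom := Over.w p₂
  refine ⟨fun {T} f g h₁ h₂ => ?_, fun T => ⟨fun a => ?_, ?_, ?_⟩⟩
  · let f' : Over.mk (f ≫ R.hom) ⟶ R := Over.homMk f
    let g' : Over.mk (f ≫ R.hom) ⟶ R := Over.homMk g (by
      simp only [Over.mk_hom, ← w₁, reassoc_of% h₁])
    exact congr(($(e.right_cancellation f' g' (Over.OverMorphism.ext h₁)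
      (Over.OverMorphism.ext h₂))).left)
  · refine ⟨a ≫ e.r.left, ?_, ?_⟩
    · simp [← Over.comp_left, e.reflexivity₁]
    · simp [← Over.comp_left, e.reflexivity₂]
  · rintro _ _ ⟨r, rfl, rfl⟩
    refine ⟨r ≫ e.s.left, ?_, ?_⟩
    · simp [← Over.comp_left, e.symmetry₁]
    · simp [← Over.comp_left, e.symmetry₂]
  · rintro _ _ _ ⟨r, rfl, hr⟩ ⟨r', hr', rfl⟩
    let f : Over.mk (r ≫ R.hom) ⟶ R := Over.homMk r
    let f' : Over.mk (r ≫ R.hom) ⟶ R := Over.homMk r' (by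
      simp only [Over.mk_hom]
      rw [← w₁, reassoc_of% hr', ← reassoc_of% hr, w₂, w₁])
    have hff' : f ≫ p₂ = f' ≫ p₁ := Over.OverMorphism.ext (hr.trans hr'.symm)
    let k := PullbackCone.IsLimit.lift e.isLimit f f' hff'
    refine ⟨(k ≫ e.t).left, ?_, ?_⟩
    · rw [← Over.comp_left, Category.assoc, e.transitivity₁,
        PullbackCone.IsLimit.lift_fst_assoc]
      rfl
    · rw [← Over.comp_left, Category.assoc, e.transitivity₂,
        PullbackCone.IsLimit.lift_snd_assoc]
      rfl

/-! ### Quotients of affine schemes -/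

/-- The morphism `π : W ⟶ Q` is a finite locally free quotient of `W` by the equivalence relation on
`W` induced by `p₁, p₂ : R ⟶ X` along `j : W ⟶ X`. -/
structure IsQuotient {R X W Q : Scheme.{u}} (p₁ p₂ : R ⟶ X) (j : W ⟶ X) (π : W ⟶ Q) : Prop where
  isFinite : IsFinite π
  flat : Flat π
  locallyOfFinitePresentation : LocallyOfFinitePresentation π
  surjective : Surjective π
  eq_iff : ∀ (T : Scheme.{u}) (a b : T ⟶ W), a ≫ π = b ≫ π ↔ Related p₁ p₂ T (a ≫ j) (b ≫ j)

lemma isBasisAlong_of_basis {A B ι : Type*} [CommRing A] [CommRing B] [Algebra A B] [Fintype ι]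
    (β : Module.Basis ι A B) : IsBasisAlong (algebraMap A B) β := by
  have : (fun v : ι → A => ∑ k, algebraMap A B (v k) * β k) = β.equivFun.symm := by
    funext v
    simp [Module.Basis.equivFun_symm_apply, Algebra.smul_def]
  rw [IsBasisAlong, this]
  exact β.equivFun.symm.bijective

lemma IsBasisAlong.of_isPushout {A B A' B' : CommRingCat.{u}} {ι : Type*} [Fintype ι] {s : A ⟶ B}
    {f : A ⟶ A'} {f' : B ⟶ B'} {s' : A' ⟶ B'} {b : ι → B} (hb : IsBasisAlong s.hom b)
    (h : IsPushout s f f' s') : IsBasisAlong s'.hom (f' ∘ b) := by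
  let := s.hom.toAlgebra
  let := f.hom.toAlgebra
  let := f'.hom.toAlgebra
  let := s'.hom.toAlgebra
  let := (s ≫ f').hom.toAlgebra
  have : IsScalarTower A A' B' := .of_algebraMap_eq' congr(($h.w).hom)
  have : IsScalarTower A B B' := .of_algebraMap_eq' rfl
  have hp : Algebra.IsPushout A A' B B' := CommRingCat.isPushout_iff_isPushout.mp h.flip
  let β : Module.Basis ι A' B' := hp.out.basis hb.toBasis
  have hβ (k : ι) : β k = f' (b k) := by
    rw [IsBaseChange.basis_apply, hb.toBasis_apply]
    rfl
  rw [← show (β : ι → B') = f' ∘ b from funext hβ]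
  exact isBasisAlong_of_basis β

variable {R X : Scheme.{u}} {p₁ p₂ : R ⟶ X}

/-- As `R ⟶ X × X` is a finite monomorphism, the functions on `R` are generated by those that are
pulled back from `X` along the two projections. -/
lemma IsRelation.exists_eq_sum (h : IsRelation p₁ p₂) [IsAffine X] [IsFinite p₁] [IsAffine R]
    (x : Γ(R, ⊤)) : ∃ (n : ℕ) (a a' : Fin n → Γ(X, ⊤)),
      x = ∑ i, p₁.appTop (a i) * p₂.appTop (a' i) := by
  let ψ : TensorProduct ℤ Γ(X, ⊤) Γ(X, ⊤) →ₐ[ℤ] Γ(R, ⊤) :=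
    Algebra.TensorProduct.productMap p₁.appTop.hom.toIntAlgHom p₂.appTop.hom.toIntAlgHom
  let ψ' := CommRingCat.ofHom ψ.toRingHom
  have h₁ : CommRingCat.ofHom (algebraMap Γ(X, ⊤) (TensorProduct ℤ Γ(X, ⊤) Γ(X, ⊤))) ≫ ψ' =
      p₁.appTop := by
    ext x
    change ψ (x ⊗ₜ 1) = _
    simp [ψ]
  have h₂ : CommRingCat.ofHom (Algebra.TensorProduct.includeRight (R := ℤ) (A := Γ(X, ⊤))
      (B := Γ(X, ⊤))).toRingHom ≫ ψ' = p₂.appTop := by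
    ext x
    change ψ (1 ⊗ₜ x) = _
    simp [ψ]
  have : Epi ψ' := by
    refine ⟨fun {Z} f g hfg => ?_⟩
    have key : Spec.map f ≫ R.isoSpec.inv = Spec.map g ≫ R.isoSpec.inv := by
      refine h.hom_ext _ _ ?_ ?_
      · rw [Category.assoc, Category.assoc, ← Scheme.isoSpec_inv_naturality, ← Spec.map_comp_assoc,
          ← Spec.map_comp_assoc, ← h₁, Category.assoc, Category.assoc, hfg]
      · rw [Category.assoc, Category.assoc, ← Scheme.isoSpec_inv_naturality, ← Spec.map_comp_assoc,
          ← Spec.map_comp_assoc, ← h₂, Category.assoc, Category.assoc, hfg]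
    rw [cancel_mono] at key
    exact Spec.map_injective key
  have hfin : ψ'.hom.Finite := by
    have := p₁.finite_appTop
    rw [← h₁] at this
    exact RingHom.Finite.of_comp_finite this
  obtain ⟨y, rfl⟩ := RingHom.surjective_of_epi_of_finite ψ' hfin x
  change ∃ (n : ℕ) (a a' : Fin n → Γ(X, ⊤)), ψ y = _
  induction y using TensorProduct.induction_on with
  | zero => exact ⟨0, Fin.elim0, Fin.elim0, by simp⟩
  | tmul a a' => exact ⟨1, fun _ => a, fun _ => a', by simp [ψ]⟩
  | add y z hy hz =>
    obtain ⟨n, a, a', ha⟩ := hy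
    obtain ⟨m, c, c', hc⟩ := hz
    refine ⟨n + m, Fin.append a c, Fin.append a' c', ?_⟩
    rw [map_add, ha, hc, Fin.sum_univ_add]
    simp

/-- The equivalence relation on an affine scheme has a quotient if the first projection is finite
and free. -/
lemma IsRelation.exists_isQuotient (h : IsRelation p₁ p₂) [IsAffine X] [IsFinite p₁]
    (hfree : letI := p₁.appTop.hom.toAlgebra; Module.Free Γ(X, ⊤) Γ(R, ⊤)) :
    ∃ (Q : Scheme.{u}) (π : X ⟶ Q), IsQuotient p₁ p₂ (𝟙 X) π := by
  have : IsAffine R := isAffine_of_isAffineHom p₁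
  obtain ⟨ι, _, b, hb⟩ : ∃ (ι : Type u) (_ : Fintype ι) (b : ι → Γ(R, ⊤)),
      IsBasisAlong p₁.appTop.hom b := by
    let := p₁.appTop.hom.toAlgebra
    have : Module.Finite Γ(X, ⊤) Γ(R, ⊤) := p₁.finite_appTop
    let β := Module.Free.chooseBasis Γ(X, ⊤) Γ(R, ⊤)
    exact ⟨_, inferInstance, β, isBasisAlong_of_basis β⟩
  obtain ⟨r, hr₁, hr₂⟩ := (h.equivalence X).refl (𝟙 X)
  obtain ⟨q₁₃, hq₁, hq₂⟩ := (h.equivalence _).trans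
    ⟨pullback.fst p₂ p₁, rfl, rfl⟩ ⟨pullback.snd p₂ p₁, pullback.condition.symm, rfl⟩
  have hD₂₃ := IsPullback.of_hasPullback p₂ p₁
  have hD₁₃ := h.isPullback hD₂₃ hq₁ hq₂
  have hcog : IsCogroupoid p₁.appTop.hom p₂.appTop.hom r.appTop.hom
      (pullback.fst p₂ p₁).appTop.hom q₁₃.appTop.hom (pullback.snd p₂ p₁).appTop.hom b :=
    { ε_s := by
        rw [← CommRingCat.hom_comp, ← Scheme.Hom.comp_appTop, hr₁]
        simp
      ε_t := by
        rw [← CommRingCat.hom_comp, ← Scheme.Hom.comp_appTop, hr₂]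
        simp
      d₁₂_s := by
        simp only [← CommRingCat.hom_comp, ← Scheme.Hom.comp_appTop, hq₁]
      d₁₂_t := by
        simp only [← CommRingCat.hom_comp, ← Scheme.Hom.comp_appTop, pullback.condition]
      d₁₃_t := by
        simp only [← CommRingCat.hom_comp, ← Scheme.Hom.comp_appTop, hq₂]
      basis := hb
      basis₁₃ := hb.of_isPushout (isPushout_appTop_of_isPullback hD₁₃).flip
      basis₂₃ := hb.of_isPushout (isPushout_appTop_of_isPullback hD₂₃).flip }
  have hgen := h.exists_eq_sum
  have hpush := hcog.isPushout hgen
  obtain ⟨hfin, hproj⟩ := hcog.finite_and_projective hgen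
  set A₀ := p₁.appTop.hom.eqLocus p₂.appTop.hom
  set c : CommRingCat.of A₀ ⟶ Γ(X, ⊤) := CommRingCat.ofHom A₀.subtype with hc
  have hfp : Module.FinitePresentation A₀ Γ(X, ⊤) := Module.finitePresentation_of_projective _ _
  have hSpec := isPullback_SpecMap_of_isPushout _ _ _ _ hpush
  have hcf : c.hom.Finite := hfin
  have hcflat : c.hom.Flat := (inferInstance : Module.Flat A₀ Γ(X, ⊤))
  have hcfp : c.hom.FinitePresentation :=
    (inferInstance : Algebra.FinitePresentation A₀ Γ(X, ⊤))
  have : IsFinite (Spec.map c) := (IsFinite.SpecMap_iff _).mpr hcf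
  have : Flat (Spec.map c) := Flat.SpecMap_iff.mpr hcflat
  have : LocallyOfFinitePresentation (Spec.map c) :=
    (LocallyOfFinitePresentation.SpecMap_iff _).mpr hcfp
  have : Surjective (Spec.map c) := by
    refine ⟨?_⟩
    exact hcf.to_isIntegral.comap_surjective Subtype.val_injective
  refine ⟨Spec (.of A₀), X.isoSpec.hom ≫ Spec.map c, inferInstance, inferInstance, inferInstance,
    inferInstance, fun T a b => ?_⟩
  rw [Category.comp_id, Category.comp_id]
  constructor
  · intro hab
    refine ⟨hSpec.lift (a ≫ X.isoSpec.hom) (b ≫ X.isoSpec.hom) (by simpa using hab) ≫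
      R.isoSpec.inv, ?_, ?_⟩
    · rw [Category.assoc, ← Scheme.isoSpec_inv_naturality, hSpec.lift_fst_assoc]
      simp
    · rw [Category.assoc, ← Scheme.isoSpec_inv_naturality, hSpec.lift_snd_assoc]
      simp
  · rintro ⟨k, rfl, rfl⟩
    simp only [Category.assoc, ← Scheme.isoSpec_hom_naturality_assoc, hSpec.w]

/-! ### Freeness near finitely many points -/

/-- A finitely presented flat module that has the same rank at finitely many primes becomes free
after the inversion of one element outside these primes: the localization at the complement of
their union is semilocal, and there a module of constant rank is free. -/
lemma exists_notMem_bijective_linearCombination {A M : Type*} [CommRing A] [AddCommGroup M]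
    [Module A M] [Module.FinitePresentation A M] [Module.Flat A M] {Z : Set (PrimeSpectrum A)}
    (hZ : Z.Finite) {n : ℕ} (hn : ∀ p ∈ Z, Module.rankAtStalk M p = n) :
    ∃ r : A, (∀ p ∈ Z, r ∉ p.asIdeal) ∧ ∃ b : Fin n → M, ∀ r', r ∣ r' →
      Function.Bijective
        (LocalizedModule.map (.powers r') (Finsupp.linearCombination A b)) := by
  let S : Submonoid A := ⨅ p ∈ Z, p.asIdeal.primeCompl
  have hS (a : A) : a ∈ S ↔ ∀ p ∈ Z, a ∉ p.asIdeal := by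
    simp [S, Submonoid.mem_iInf, Ideal.primeCompl]
  let A' := Localization S
  let M' := LocalizedModule S M
  have hmax (m : MaximalSpectrum A') :
      ∃ p ∈ Z, Ideal.comap (algebraMap A A') m.asIdeal ≤ p.asIdeal := by
    obtain ⟨p₀, hp₀⟩ : Z.Nonempty := by
      by_contra! hne
      subst hne
      have h0 : (0 : A) ∈ S := (hS 0).mpr (by simp)
      exact m.isMaximal.ne_top (Ideal.eq_top_of_isUnit_mem _ (Ideal.zero_mem _)
        (by simpa using IsLocalization.map_units A' ⟨0, h0⟩))
    obtain ⟨p, hp, h⟩ := (Ideal.subset_union_prime_finite hZ (f := fun p => p.asIdeal) p₀ p₀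
      fun p _ _ _ => p.isPrime).mp (show
        (Ideal.comap (algebraMap A A') m.asIdeal : Set A) ⊆ ⋃ p ∈ Z, (p.asIdeal : Set A) by
        intro a ha
        by_contra hne
        have haS : a ∈ S := (hS a).mpr fun p hp hap => hne (Set.mem_biUnion hp hap)
        exact m.isMaximal.ne_top (Ideal.eq_top_of_isUnit_mem _ ha
          (IsLocalization.map_units A' ⟨a, haS⟩)))
    exact ⟨p, hp, h⟩
  choose q hqZ hq using hmax
  -- A maximal ideal of the localization is generated by one of the given primes.
  have hmap (m : MaximalSpectrum A') : m.asIdeal = (q m).asIdeal.map (algebraMap A A') := by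
    refine m.isMaximal.eq_of_le ?_ ?_
    · have hd : Disjoint (S : Set A) (q m).asIdeal :=
        Set.disjoint_left.mpr fun a ha => (hS a).mp ha _ (hqZ m)
      exact (IsLocalization.isPrime_of_isPrime_disjoint S A' _ (q m).isPrime hd).ne_top
    · rw [← IsLocalization.map_under S A' m.asIdeal]
      exact Ideal.map_mono (hq m)
  have : Finite (MaximalSpectrum A') := by
    have := hZ.to_subtype
    refine Finite.of_injective (fun m => (⟨q m, hqZ m⟩ : Z)) fun m m' h => ?_
    ext1
    rw [hmap m, hmap m', show q m = q m' from congrArg Subtype.val h]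
  have hbc := LocalizedModule.isBaseChange S M
  have : Module.Finite A' M' := .of_isLocalizedModule S (LocalizedModule.mkLinearMap S M)
  have : Module.Flat A' M' := .of_isLocalizedModule A' S (LocalizedModule.mkLinearMap S M)
  have hrk (m : MaximalSpectrum A') :
      Module.finrank (A' ⧸ m.asIdeal) (TensorProduct A' (A' ⧸ m.asIdeal) M') = n := by
    let := Ideal.Quotient.field m.asIdeal
    have := m.isMaximal.isPrime
    rw [← hn _ (hqZ m), ← Module.rankAtStalk_eq_of_le_of_finite_of_flat M
      (p := PrimeSpectrum.comap (algebraMap A A') m.toPrimeSpectrum) (hq m),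
      ← Module.rankAtStalk_isBaseChange hbc, Module.rankAtStalk_eq]
    have e := (TensorProduct.AlgebraTensorModule.cancelBaseChange A' (A' ⧸ m.asIdeal)
      m.asIdeal.ResidueField m.asIdeal.ResidueField M').finrank_eq
    rw [Module.finrank_baseChange] at e
    exact e
  obtain ⟨β⟩ := Module.nonempty_basis_of_flat_of_finrank_eq A' M' n hrk
  -- After multiplication by units, the basis consists of elements of `M`.
  choose x hx using fun i => IsLocalizedModule.mk'_surjective S
    (LocalizedModule.mkLinearMap S M) (β i)
  let b : Fin n → M := fun i => (x i).1
  have hb (i : Fin n) : LocalizedModule.mkLinearMap S M (b i) =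
      algebraMap A A' (x i).2 • β i := by
    rw [← hx i, algebraMap_smul]
    exact (IsLocalizedModule.mk'_cancel' _ _ _).symm
  let β' := β.isUnitSMul (w := fun i => algebraMap A A' (x i).2)
    fun i => IsLocalization.map_units A' (x i).2
  have hβ' : ⇑β' = LocalizedModule.mkLinearMap S M ∘ b := by
    funext i
    rw [Module.Basis.isUnitSMul_apply, Function.comp_apply, hb]
  obtain ⟨r, hr, h⟩ := exists_bijective_map_powers S
    (Finsupp.mapRange.linearMap (Algebra.linearMap A A')) (LocalizedModule.mkLinearMap S M)
    (Finsupp.linearCombination A b) (by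
      rw [IsLocalizedModule.map_linearCombination, ← hβ']
      have : ⇑(Finsupp.linearCombination A' β') = ⇑β'.repr.symm := by
        funext v
        rw [Module.Basis.repr_symm_apply]
      rw [LinearMap.coe_restrictScalars, this]
      exact β'.repr.symm.bijective)
  exact ⟨r, (hS r).mp hr, b, h⟩

/-- A family that becomes a basis after the inversion of `r` is a basis along the localization
of `s`. -/
lemma isBasisAlong_of_bijective_linearCombination {A B A' B' : CommRingCat.{u}} {s : A ⟶ B}
    {f : A ⟶ A'} {f' : B ⟶ B'} {s' : A' ⟶ B'} (hcomm : s ≫ f' = f ≫ s') (r : A)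
    (hf : letI := f.hom.toAlgebra; IsLocalization.Away r A')
    (hf' : letI := f'.hom.toAlgebra; IsLocalization.Away (s r) B') {n : ℕ} (b : Fin n → B)
    (hb : letI := s.hom.toAlgebra; Function.Bijective
      (LocalizedModule.map (.powers r) (Finsupp.linearCombination A b))) :
    IsBasisAlong s'.hom (f' ∘ b) := by
  let := s.hom.toAlgebra
  let := f.hom.toAlgebra
  let := f'.hom.toAlgebra
  let := s'.hom.toAlgebra
  let := (s ≫ f').hom.toAlgebra
  have : IsScalarTower A A' B' := .of_algebraMap_eq' congr(($hcomm).hom)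
  have : IsScalarTower A B B' := .of_algebraMap_eq' rfl
  have : IsLocalization (Algebra.algebraMapSubmonoid B (.powers r)) B' := by
    rw [Algebra.algebraMapSubmonoid_powers]
    exact hf'
  have hl : IsLocalizedModule (.powers r) (IsScalarTower.toAlgHom A B B').toLinearMap :=
    inferInstance
  rw [← IsLocalizedModule.map_bijective_iff_localizedModuleMap_bijective
    (Finsupp.mapRange.linearMap (Algebra.linearMap A A'))
    (IsScalarTower.toAlgHom A B B').toLinearMap, IsLocalizedModule.map_linearCombination] at hb
  have : (fun v : Fin n → A' => ∑ k, s' (v k) * f' (b k)) =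
      Finsupp.linearCombination A' ((IsScalarTower.toAlgHom A B B').toLinearMap ∘ b) ∘
        (Finsupp.linearEquivFunOnFinite A' A' (Fin n)).symm := by
    funext v
    simp [Finsupp.linearCombination_eq_fintype_linearCombination_apply,
      Fintype.linearCombination_apply, Algebra.smul_def]
    rfl
  rw [IsBasisAlong]
  exact (congrArg Function.Bijective this).mpr (hb.comp (LinearEquiv.bijective _))

/-! ### Finite locally free morphisms -/

section FiniteLocallyFree

variable {X Y : Scheme.{u}} (f : X ⟶ Y)

lemma isPullback_fromSpec [IsAffineHom f] {V : Y.Opens} (hV : IsAffineOpen V) :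
    IsPullback (Spec.map (f.app V)) (hV.preimage f).fromSpec hV.fromSpec f := by
  refine IsOpenImmersion.isPullback _ _ _ _ ?_ ?_
  · rw [← Scheme.Hom.appLE_eq_app, IsAffineOpen.SpecMap_appLE_fromSpec]
  · rw [hV.opensRange_fromSpec, (hV.preimage f).opensRange_fromSpec]

lemma isPushout_app [IsAffineHom f] {V W : Y.Opens} (hV : IsAffineOpen V) (hW : IsAffineOpen W)
    (h : W ≤ V) : IsPushout (f.app V) (Y.presheaf.map (homOfLE h).op)
      (X.presheaf.map (homOfLE (f.preimage_mono h)).op) (f.app W) := by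
  have : IsPullback (Spec.map (X.presheaf.map (homOfLE (f.preimage_mono h)).op))
      (Spec.map (f.app W)) (Spec.map (f.app V)) (Spec.map (Y.presheaf.map (homOfLE h).op)) := by
    refine IsPullback.of_right (h₁₂ := (hV.preimage f).fromSpec) (h₂₂ := hV.fromSpec) ?_ ?_
      (isPullback_fromSpec f hV).flip
    · rw [IsAffineOpen.map_fromSpec, IsAffineOpen.map_fromSpec _ hW]
      exact (isPullback_fromSpec f hW).flip
    · rw [← Spec.map_comp, ← Spec.map_comp, f.naturality]
      rfl
  exact (IsPullback.of_map Scheme.Spec (congrArg Quiver.Hom.op (f.naturality (homOfLE h).op)).symm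
    this).unop.flip

variable {f}

lemma IsBasisAlong.app_of_le [IsAffineHom f] {V W : Y.Opens} (hV : IsAffineOpen V)
    (hW : IsAffineOpen W) (h : W ≤ V) {ι : Type*} [Fintype ι] {b : ι → Γ(X, f ⁻¹ᵁ V)}
    (hb : IsBasisAlong (f.app V).hom b) :
    IsBasisAlong (f.app W).hom (X.presheaf.map (homOfLE (f.preimage_mono h)).op ∘ b) :=
  hb.of_isPushout (isPushout_app f hV hW h)

lemma rankAtStalk_app [IsFinite f] [Flat f] {V : Y.Opens} (hV : IsAffineOpen V) (y : V) :
    letI := (f.app V).hom.toAlgebra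
    Module.rankAtStalk Γ(X, f ⁻¹ᵁ V) (hV.primeIdealOf y) = f.finrank y := by
  let := (f.app V).hom.toAlgebra
  have : Module.Finite Γ(Y, V) Γ(X, f ⁻¹ᵁ V) := f.finite_app V hV
  have : Module.Flat Γ(Y, V) Γ(X, f ⁻¹ᵁ V) := by
    have := f.flat_appLE hV (hV.preimage f) le_rfl
    rwa [Scheme.Hom.appLE_eq_app] at this
  rw [← Scheme.Hom.finrank_SpecMap_algebraMap, ← hV.fromSpec_primeIdealOf y]
  exact Scheme.Hom.finrank_of_isPullback _ _ _ _ (isPullback_fromSpec f hV).flip _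

/-- A finite flat morphism of finite presentation is free over a principal open neighbourhood of any
finite set of points of an affine open on which its rank is constant. -/
lemma exists_basicOpen_isBasisAlong [IsFinite f] [Flat f] [LocallyOfFinitePresentation f]
    {V : Y.Opens} (hV : IsAffineOpen V) {Z : Set Y} (hZ : Z.Finite) (hZV : Z ⊆ V) {n : ℕ}
    (hn : ∀ z ∈ Z, f.finrank z = n) :
    ∃ r : Γ(Y, V), Z ⊆ Y.basicOpen r ∧ ∃ b : Fin n → Γ(X, f ⁻¹ᵁ Y.basicOpen r),
      IsBasisAlong (f.app (Y.basicOpen r)).hom b := by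
  let := (f.app V).hom.toAlgebra
  have : Module.Finite Γ(Y, V) Γ(X, f ⁻¹ᵁ V) := f.finite_app V hV
  have : Module.Flat Γ(Y, V) Γ(X, f ⁻¹ᵁ V) := by
    have := f.flat_appLE hV (hV.preimage f) le_rfl
    rwa [Scheme.Hom.appLE_eq_app] at this
  have : Algebra.FinitePresentation Γ(Y, V) Γ(X, f ⁻¹ᵁ V) := by
    have := f.finitePresentation_appLE hV (hV.preimage f) le_rfl
    rwa [Scheme.Hom.appLE_eq_app] at this
  have : Module.FinitePresentation Γ(Y, V) Γ(X, f ⁻¹ᵁ V) :=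
    .of_finite_of_finitePresentation _ _
  obtain ⟨r, hr, b, hb⟩ := exists_notMem_bijective_linearCombination (A := Γ(Y, V))
    (M := Γ(X, f ⁻¹ᵁ V)) (Z := hV.primeIdealOf '' (Subtype.val ⁻¹' Z))
    ((hZ.preimage Subtype.val_injective.injOn).image _) (n := n) (by
      rintro _ ⟨z, hz, rfl⟩
      rw [rankAtStalk_app hV z]
      exact hn _ hz)
  refine ⟨r, fun z hz => ?_, _, isBasisAlong_of_bijective_linearCombination
    (f := Y.presheaf.map (homOfLE (Y.basicOpen_le r)).op)
    (f' := X.presheaf.map (homOfLE (f.preimage_mono (Y.basicOpen_le r))).op)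
    (f.naturality _).symm r (hV.isLocalization_basicOpen r) ?_ b (hb r dvd_rfl)⟩
  · have := hr _ ⟨⟨z, hZV hz⟩, hz, rfl⟩
    have h : hV.primeIdealOf ⟨z, hZV hz⟩ ∈ PrimeSpectrum.basicOpen r := this
    rw [← hV.fromSpec_preimage_basicOpen] at h
    have h' : hV.fromSpec (hV.primeIdealOf ⟨z, hZV hz⟩) ∈ Y.basicOpen r := h
    rwa [hV.fromSpec_primeIdealOf] at h'
  · exact (hV.preimage f).isLocalization_of_eq_basicOpen _ _ (Scheme.preimage_basicOpen f r)

lemma isFiniteLocallyFree_iff : IsFiniteLocallyFree f ↔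
    IsFinite f ∧ Flat f ∧ LocallyOfFinitePresentation f := by
  constructor
  · intro h
    have := h.isFinite
    have key (x : X) : ∃ (U : Y.affineOpens) (V : X.affineOpens) (_ : x ∈ V.1)
        (e : V.1 ≤ f ⁻¹ᵁ U.1),
        (f.appLE U V e).hom.Flat ∧ (f.appLE U V e).hom.FinitePresentation := by
      obtain ⟨V, hV, hx, hfree⟩ := h.locallyFree (f x)
      refine ⟨⟨V, hV⟩, ⟨f ⁻¹ᵁ V, hV.preimage f⟩, hx, le_rfl, ?_⟩
      rw [Scheme.Hom.appLE_eq_app]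
      let := (f.app V).hom.toAlgebra
      have : Module.Free Γ(Y, V) Γ(X, f ⁻¹ᵁ V) := hfree
      have : Module.Finite Γ(Y, V) Γ(X, f ⁻¹ᵁ V) := f.finite_app V hV
      have := Module.finitePresentation_of_projective Γ(Y, V) Γ(X, f ⁻¹ᵁ V)
      exact ⟨(inferInstance : Module.Flat Γ(Y, V) Γ(X, f ⁻¹ᵁ V)),
        (inferInstance : Algebra.FinitePresentation Γ(Y, V) Γ(X, f ⁻¹ᵁ V))⟩
    refine ⟨h.isFinite, ?_, ?_⟩
    · rw [HasRingHomProperty.iff_exists_appLE (P := @Flat)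
        (RingHom.Flat.stableUnderComposition.stableUnderCompositionWithLocalizationAway
          RingHom.Flat.holdsForLocalizationAway).1]
      exact fun x => (key x).imp fun _ => .imp fun _ => .imp fun _ => .imp fun _ => And.left
    · rw [HasRingHomProperty.iff_exists_appLE (P := @LocallyOfFinitePresentation)
        (RingHom.finitePresentation_stableUnderComposition
          |>.stableUnderCompositionWithLocalizationAway
            RingHom.finitePresentation_holdsForLocalizationAway).1]
      exact fun x => (key x).imp fun _ => .imp fun _ => .imp fun _ => .imp fun _ => And.right
  · rintro ⟨_, _, _⟩
    refine ⟨inferInstance, fun y => ?_⟩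
    obtain ⟨V, hV, hy, -⟩ := exists_isAffineOpen_mem_and_subset (U := ⊤) (X := Y) (x := y) trivial
    obtain ⟨r, hr, b, hb⟩ := exists_basicOpen_isBasisAlong (f := f) hV (Set.finite_singleton y)
      (by simpa using hy) (n := f.finrank y) (by simp)
    refine ⟨_, hV.basicOpen r, hr rfl, ?_⟩
    let := (f.app (Y.basicOpen r)).hom.toAlgebra
    exact Module.Free.of_basis hb.toBasis

end FiniteLocallyFree

/-! ### Saturated affine neighbourhoods -/

section Algebra

/-- If the norm of `x` vanishes at a prime, then `x` vanishes at a prime above it: otherwise `x`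
divides an element of the base outside the prime, and its norm divides a power of this element. -/
lemma IsBasisAlong.exists_mem_of_det_mem {A B ι : Type*} [CommRing A] [CommRing B] [Fintype ι]
    [DecidableEq ι] {s : A →+* B} {b : ι → B} (hb : IsBasisAlong s b) {x : B} {M : Matrix ι ι A}
    (hM : IsMulMatrix s b x M) (q : PrimeSpectrum A) (hq : M.det ∈ q.asIdeal) :
    ∃ P : PrimeSpectrum B, PrimeSpectrum.comap s P = q ∧ x ∈ P.asIdeal := by
  let := s.toAlgebra
  have := Module.Free.of_basis hb.toBasis
  have := Module.Finite.of_basis hb.toBasis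
  have hdet : M.det = Algebra.norm A x := by
    rw [← hb.toMatrix_mul_eq hM, LinearMap.det_toMatrix, Algebra.norm_apply]
    rfl
  obtain ⟨P, hP, hP', hPq⟩ := Ideal.exists_ideal_over_prime_of_isIntegral q.asIdeal
    (Ideal.span {x}) (by
      intro a ha
      obtain ⟨y, hy⟩ := Ideal.mem_span_singleton.mp (Ideal.mem_comap.mp ha)
      have h := congrArg (Algebra.norm A) hy
      rw [map_mul, ← hdet, Algebra.norm_algebraMap_of_basis hb.toBasis] at h
      exact q.isPrime.mem_of_pow_mem _ (h ▸ Ideal.mul_mem_right _ _ hq))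
  exact ⟨⟨P, hP'⟩, PrimeSpectrum.ext hPq, hP (Ideal.mem_span_singleton_self x)⟩

/-- Finitely many points of an affine scheme have arbitrarily small principal open neighbourhoods, by
prime avoidance. -/
lemma exists_subset_basicOpen_le {A : Type*} [CommRing A] {Z : Set (PrimeSpectrum A)}
    (hZ : Z.Finite) {W : TopologicalSpace.Opens (PrimeSpectrum A)} (hW : Z ⊆ W) :
    ∃ f : A, Z ⊆ PrimeSpectrum.basicOpen f ∧ PrimeSpectrum.basicOpen f ≤ W := by
  obtain rfl | ⟨p₀, -⟩ := Z.eq_empty_or_nonempty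
  · exact ⟨0, by simp⟩
  obtain ⟨I, hI⟩ := (PrimeSpectrum.isClosed_iff_zeroLocus_ideal _).mp W.isOpen.isClosed_compl
  have h : ¬ (I : Set A) ⊆ ⋃ p ∈ Z, (p.asIdeal : Set A) := by
    rw [Ideal.subset_union_prime_finite hZ (f := fun p => p.asIdeal) p₀ p₀
      fun p _ _ _ => p.isPrime]
    rintro ⟨p, hp, hIp⟩
    have : p ∈ (W : Set (PrimeSpectrum A))ᶜ := by
      rw [hI]
      exact hIp
    exact this (hW hp)
  obtain ⟨f, hfI, hf⟩ := Set.not_subset.mp h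
  refine ⟨f, fun p hp hfp => hf (Set.mem_biUnion hp hfp), fun p hp => ?_⟩
  by_contra hne
  have : p ∈ (W : Set (PrimeSpectrum A))ᶜ := hne
  rw [hI] at this
  exact hp (this hfI)

end Algebra

lemma exists_subset_basicOpen_le_of_isAffineOpen {X : Scheme.{u}} {U : X.Opens}
    (hU : IsAffineOpen U) {Z : Set X} (hZ : Z.Finite) {W : X.Opens} (hZW : Z ⊆ W) (hZU : Z ⊆ U) :
    ∃ f : Γ(X, U), Z ⊆ X.basicOpen f ∧ X.basicOpen f ≤ W := by
  obtain ⟨f, hf, hf'⟩ := exists_subset_basicOpen_le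
    (Z := hU.primeIdealOf '' (Subtype.val ⁻¹' Z)) (W := hU.fromSpec ⁻¹ᵁ W)
    ((hZ.preimage Subtype.val_injective.injOn).image _) (by
      rintro _ ⟨z, hz, rfl⟩
      change hU.fromSpec (hU.primeIdealOf z) ∈ W
      rw [hU.fromSpec_primeIdealOf z]
      exact hZW hz)
  rw [← hU.fromSpec_preimage_basicOpen] at hf hf'
  refine ⟨f, fun z hz => ?_, fun z hz => ?_⟩
  · have h : hU.fromSpec (hU.primeIdealOf ⟨z, hZU hz⟩) ∈ X.basicOpen f :=
      hf ⟨⟨z, hZU hz⟩, hz, rfl⟩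
    rwa [hU.fromSpec_primeIdealOf] at h
  · have hzU := X.basicOpen_le f hz
    have h : hU.fromSpec (hU.primeIdealOf ⟨z, hzU⟩) ∈ W := hf' (by
      change hU.fromSpec (hU.primeIdealOf ⟨z, hzU⟩) ∈ X.basicOpen f
      rwa [hU.fromSpec_primeIdealOf])
    rwa [hU.fromSpec_primeIdealOf] at h

section Saturated

variable {R X : Scheme.{u}} {p₁ p₂ : R ⟶ X}

/-- The symmetry of the relation is an automorphism of `R` that exchanges the two projections. -/
lemma IsRelation.exists_iso (h : IsRelation p₁ p₂) : ∃ e : R ≅ R, e.hom ≫ p₁ = p₂ := by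
  obtain ⟨s, h₁, h₂⟩ := (h.equivalence R).symm ⟨𝟙 R, Category.id_comp _, Category.id_comp _⟩
  have : s ≫ s = 𝟙 R := h.hom_ext _ _ (by rw [Category.assoc, h₁, h₂, Category.id_comp])
    (by rw [Category.assoc, h₂, h₁, Category.id_comp])
  exact ⟨⟨s, s, this, this⟩, h₁⟩

/-- The relation on the points of `X` induced by an equivalence relation is an equivalence relation;
for transitivity, two points of `R` with a common image lift to a point of the fibre product. -/
lemma IsRelation.equivalence_points (h : IsRelation p₁ p₂) :
    Equivalence fun y z : X => ∃ r : R, p₁ r = y ∧ p₂ r = z where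
  refl y := by
    obtain ⟨s, h₁, h₂⟩ := (h.equivalence X).refl (𝟙 X)
    refine ⟨s y, ?_, ?_⟩
    · rw [← Scheme.Hom.comp_apply, h₁]
      rfl
    · rw [← Scheme.Hom.comp_apply, h₂]
      rfl
  symm := by
    rintro _ _ ⟨r, rfl, rfl⟩
    obtain ⟨s, h₁, h₂⟩ := (h.equivalence R).symm ⟨𝟙 R, Category.id_comp _, Category.id_comp _⟩
    exact ⟨s r, by rw [← Scheme.Hom.comp_apply, h₁], by rw [← Scheme.Hom.comp_apply, h₂]⟩
  trans := by
    rintro _ _ _ ⟨r, rfl, hr⟩ ⟨r', hr', rfl⟩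
    obtain ⟨z, rfl, rfl⟩ := Scheme.Pullback.exists_preimage_pullback r r' (hr.trans hr'.symm)
    obtain ⟨t, h₁, h₂⟩ := (h.equivalence _).trans
      ⟨pullback.fst p₂ p₁, rfl, rfl⟩ ⟨pullback.snd p₂ p₁, pullback.condition.symm, rfl⟩
    refine ⟨t z, ?_, ?_⟩
    · rw [← Scheme.Hom.comp_apply, h₁, Scheme.Hom.comp_apply]
    · rw [← Scheme.Hom.comp_apply, h₂, Scheme.Hom.comp_apply]

variable (p₁ p₂) in
/-- An open subset is saturated if it is a union of equivalence classes of points. -/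
def IsSaturated (U : X.Opens) : Prop := p₁ ⁻¹ᵁ U = p₂ ⁻¹ᵁ U

lemma IsSaturated.mem_iff {U : X.Opens} (hU : IsSaturated p₁ p₂ U) (r : R) :
    p₁ r ∈ U ↔ p₂ r ∈ U :=
  SetLike.ext_iff.mp hU r

/-- The points whose equivalence class lies in an open subset form a saturated open subset. -/
lemma IsRelation.exists_isSaturated (h : IsRelation p₁ p₂) [IsFinite p₂] (U : X.Opens) :
    ∃ W : X.Opens, W ≤ U ∧ IsSaturated p₁ p₂ W ∧ ∀ y, y ∈ W ↔ ∀ r, p₂ r = y → p₁ r ∈ U := by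
  let W : X.Opens := ⟨(p₂ '' (p₁ ⁻¹' (Uᶜ : Set X)))ᶜ, ((p₂.isClosedMap _
    (U.isOpen.isClosed_compl.preimage p₁.continuous))).isOpen_compl⟩
  have hW (y : X) : y ∈ W ↔ ∀ r, p₂ r = y → p₁ r ∈ U := by
    change ¬ (∃ r, p₁ r ∉ U ∧ p₂ r = y) ↔ _
    simp only [not_exists, not_and, not_imp_comm]
    grind
  refine ⟨W, fun y hy => ?_, ?_, hW⟩
  · obtain ⟨r, hr₁, hr₂⟩ := h.equivalence_points.refl y
    exact hr₁ ▸ (hW y).mp hy r hr₂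
  · ext r
    change p₁ r ∈ W ↔ p₂ r ∈ W
    rw [hW, hW]
    refine ⟨fun H r' hr' => ?_, fun H r' hr' => ?_⟩
    · obtain ⟨t, ht₁, ht₂⟩ := h.equivalence_points.trans ⟨r', rfl, hr'⟩
        (h.equivalence_points.symm ⟨r, rfl, rfl⟩)
      exact ht₁ ▸ H t ht₂
    · obtain ⟨t, ht₁, ht₂⟩ := h.equivalence_points.trans ⟨r', rfl, hr'⟩ ⟨r, rfl, rfl⟩
      exact ht₁ ▸ H t ht₂

/-- The rank of the first projection is constant on equivalence classes. -/
lemma IsRelation.finrank_eq (h : IsRelation p₁ p₂) [IsFinite p₁] [Flat p₁] (r : R) :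
    p₁.finrank (p₁ r) = p₁.finrank (p₂ r) := by
  obtain ⟨q₁₃, hq₁, hq₂⟩ := (h.equivalence _).trans
    ⟨pullback.fst p₂ p₁, rfl, rfl⟩ ⟨pullback.snd p₂ p₁, pullback.condition.symm, rfl⟩
  have hD₂₃ := IsPullback.of_hasPullback p₂ p₁
  have hD₁₃ := h.isPullback hD₂₃ hq₁ hq₂
  rw [← Scheme.Hom.finrank_of_isPullback _ _ _ _ hD₂₃.flip r,
    ← Scheme.Hom.finrank_of_isPullback _ _ _ _ hD₁₃.flip r]

/-- A point whose equivalence class lies in an affine open subset has a saturated affine open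
neighbourhood over which the first projection is free. The class lies in a principal open subset
of the affine one over which the first projection is free. The largest saturated subset of this
principal open subset is again principal in it, defined by the norm along `p₁` of the pullback along
`p₂` of the equation. -/
lemma IsRelation.exists_isSaturated_isAffineOpen (h : IsRelation p₁ p₂) [IsFinite p₁] [Flat p₁]
    [LocallyOfFinitePresentation p₁] [IsFinite p₂] {x : X} {U : X.Opens} (hU : IsAffineOpen U)
    (hx : p₁ '' (p₂ ⁻¹' {x}) ⊆ U) :
    ∃ W : X.Opens, x ∈ W ∧ IsAffineOpen W ∧ IsSaturated p₁ p₂ W ∧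
      ∃ (n : ℕ) (b : Fin n → Γ(R, p₁ ⁻¹ᵁ W)), IsBasisAlong (p₁.app W).hom b := by
  have hfin : (p₁ '' (p₂ ⁻¹' {x})).Finite := (p₂.finite_preimage_singleton x).image _
  have hmem {y : X} : y ∈ p₁ '' (p₂ ⁻¹' {x}) ↔ ∃ r, p₁ r = y ∧ p₂ r = x := by
    simp [and_comm]
  obtain ⟨U', hU'U, hU'sat, hU'⟩ := h.exists_isSaturated U
  have hxU' : p₁ '' (p₂ ⁻¹' {x}) ⊆ U' := by
    intro y hy
    refine (hU' y).mpr fun r hr => hx (hmem.mpr ?_)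
    exact h.equivalence_points.trans ⟨r, rfl, hr⟩ (hmem.mp hy)
  obtain ⟨g, hg, b, hb⟩ := exists_basicOpen_isBasisAlong (f := p₁) hU hfin hx
    (n := p₁.finrank x) (by
      rintro _ ⟨r, rfl, rfl⟩
      exact h.finrank_eq r)
  obtain ⟨f, hf, hfW⟩ := exists_subset_basicOpen_le_of_isAffineOpen hU hfin
    (W := X.basicOpen g ⊓ U') (fun y hy => ⟨hg hy, hxU' hy⟩) hx
  set V := X.basicOpen f with hVdef
  have hV : IsAffineOpen V := hU.basicOpen f
  have hb := hb.app_of_le (hU.basicOpen g) hV (hfW.trans inf_le_left)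
  set b' := R.presheaf.map (homOfLE (p₁.preimage_mono (hfW.trans inf_le_left))).op ∘ b
  have hle : p₁ ⁻¹ᵁ V ≤ p₂ ⁻¹ᵁ U := fun r hr =>
    hU'U ((hU'sat.mem_iff r).mp (hfW hr).2)
  set u : Γ(R, p₁ ⁻¹ᵁ V) := p₂.appLE U (p₁ ⁻¹ᵁ V) hle f with hu
  have hu' (r : R) (hr : p₁ r ∈ V) : r ∈ R.basicOpen u ↔ p₂ r ∈ V := by
    rw [hu, Scheme.Hom.appLE, CommRingCat.comp_apply, Scheme.basicOpen_res,
      ← Scheme.preimage_basicOpen]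
    exact and_iff_right hr
  obtain ⟨M, hM⟩ := hb.exists_isMulMatrix u
  obtain ⟨W, hWV, hWsat, hW⟩ := h.exists_isSaturated V
  have hWdet : W = X.basicOpen M.det := by
    ext y
    by_cases hy : y ∈ V
    swap
    · exact iff_of_false (fun h => hy (hWV h)) (fun h => hy (X.basicOpen_le _ h))
    constructor
    · intro hyW
      by_contra hydet
      obtain ⟨P, hP, huP⟩ := hb.exists_mem_of_det_mem hM (hV.primeIdealOf ⟨y, hy⟩) (by
        by_contra hne
        have hne' : hV.primeIdealOf ⟨y, hy⟩ ∈ PrimeSpectrum.basicOpen M.det := hne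
        rw [← hV.fromSpec_preimage_basicOpen] at hne'
        have hne'' : hV.fromSpec (hV.primeIdealOf ⟨y, hy⟩) ∈ X.basicOpen M.det := hne'
        rw [hV.fromSpec_primeIdealOf] at hne''
        exact hydet hne'')
      have hr : p₁ ((hV.preimage p₁).fromSpec P) = y := by
        refine congr($((isPullback_fromSpec p₁ hV).w) P).symm.trans ?_
        exact (congrArg hV.fromSpec hP).trans (hV.fromSpec_primeIdealOf _)
      refine absurd huP (?_ : P ∈ PrimeSpectrum.basicOpen u)
      rw [← (hV.preimage p₁).fromSpec_preimage_basicOpen]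
      change (hV.preimage p₁).fromSpec P ∈ R.basicOpen u
      rw [hu' _ (hr ▸ hy)]
      exact hWV ((hWsat.mem_iff _).mp (hr ▸ hyW))
    · intro hydet
      refine (hW y).mpr fun r hr => ?_
      obtain ⟨r', hr'₁, hr'₂⟩ := h.equivalence_points.symm ⟨r, rfl, hr⟩
      rw [← hr'₂, ← hu' r' (hr'₁ ▸ hy)]
      obtain ⟨c, hc⟩ := hb.dvd_det hM
      have hr'' : r' ∈ R.basicOpen (p₁.app V M.det) := by
        rw [← Scheme.preimage_basicOpen]
        change p₁ r' ∈ X.basicOpen M.det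
        rwa [hr'₁]
      have hc' : p₁.app V M.det = u * c := hc
      rw [hc', Scheme.basicOpen_mul] at hr''
      exact hr''.1
  have hWaff : IsAffineOpen W := hWdet ▸ hV.basicOpen _
  refine ⟨W, (hW x).mpr fun r hr => hf ⟨r, hr, rfl⟩, hWaff, hWsat, _, _,
    hb.app_of_le hV hWaff hWV⟩

/-- Morphisms into a saturated open subset are related in it as soon as they are related. -/
lemma IsSaturated.related_iff {U : X.Opens} (hU : IsSaturated p₁ p₂ U)
    (T : Scheme.{u}) (a b : T ⟶ U) :
    Related (p₁ ∣_ U) (IsOpenImmersion.lift U.ι ((p₁ ⁻¹ᵁ U).ι ≫ p₂) (by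
      rw [Scheme.Opens.range_ι]
      rintro _ ⟨r, rfl⟩
      exact (hU.mem_iff _).mp r.2)) T a b ↔ Related p₁ p₂ T (a ≫ U.ι) (b ≫ U.ι) := by
  constructor
  · rintro ⟨k, rfl, rfl⟩
    refine ⟨k ≫ (p₁ ⁻¹ᵁ U).ι, ?_, ?_⟩
    · simp
    · simp [IsOpenImmersion.lift_fac]
  · rintro ⟨k, h₁, h₂⟩
    refine ⟨(isPullback_morphismRestrict p₁ U).lift a k h₁.symm, ?_, ?_⟩
    · simp
    · rw [← cancel_mono U.ι, Category.assoc, IsOpenImmersion.lift_fac, IsPullback.lift_snd_assoc,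
        h₂]

lemma IsRelation.exists_isQuotient_of_isAffineOpen (h : IsRelation p₁ p₂) [IsFinite p₁]
    {W : X.Opens} (hW : IsAffineOpen W) (hWsat : IsSaturated p₁ p₂ W) {n : ℕ}
    {b : Fin n → Γ(R, p₁ ⁻¹ᵁ W)} (hb : IsBasisAlong (p₁.app W).hom b) :
    ∃ (Q : Scheme.{u}) (π : W.toScheme ⟶ Q), IsQuotient p₁ p₂ W.ι π := by
  have hrel := hWsat.related_iff
  set p₂' := IsOpenImmersion.lift W.ι ((p₁ ⁻¹ᵁ W).ι ≫ p₂) (by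
      rw [Scheme.Opens.range_ι]
      rintro _ ⟨r, rfl⟩
      exact (hWsat.mem_iff _).mp r.2) with hp₂'
  have : IsAffine W := hW
  have h' : IsRelation (p₁ ∣_ W) p₂' := h.restrict (p₁ ⁻¹ᵁ W).ι W.ι (by simp)
    (by simp [hp₂', IsOpenImmersion.lift_fac]) hrel
  obtain ⟨Q, π, hπ⟩ := h'.exists_isQuotient (by
    have hb' : IsBasisAlong (p₁ ∣_ W).appTop.hom ((p₁ ⁻¹ᵁ W).topIso.inv ∘ b) := by
      refine hb.of_isPushout (f := W.topIso.inv) (IsPushout.of_vert_isIso ⟨?_⟩)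
      rw [morphismRestrict_appTop, Scheme.Opens.topIso_inv, Scheme.Opens.topIso_inv,
        Scheme.Hom.app_eq_appLE, Scheme.Hom.app_eq_appLE, Scheme.Hom.appLE_map]
      erw [Scheme.Hom.appLE_map, Scheme.Hom.map_appLE]
      rfl
    let := (p₁ ∣_ W).appTop.hom.toAlgebra
    exact Module.Free.of_basis hb'.toBasis)
  refine ⟨Q, π, hπ.1, hπ.2, hπ.3, hπ.4, fun T a b => ?_⟩
  rw [hπ.eq_iff, Category.comp_id, Category.comp_id, hrel]

end Saturated

/-! ### Gluing quotients of saturated open subsets -/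

section Gluing

variable {R X : Scheme.{u}} {p₁ p₂ : R ⟶ X}

/-- Being related is local on the test scheme. -/
lemma IsRelation.related_of_openCover (h : IsRelation p₁ p₂) {T : Scheme.{u}} {a b : T ⟶ X}
    (𝒰 : T.OpenCover) (H : ∀ i, Related p₁ p₂ (𝒰.X i) (𝒰.f i ≫ a) (𝒰.f i ≫ b)) :
    Related p₁ p₂ T a b := by
  choose r hr₁ hr₂ using H
  have hglue (i j : 𝒰.I₀) : pullback.fst (𝒰.f i) (𝒰.f j) ≫ r i = pullback.snd _ _ ≫ r j := by
    refine h.hom_ext _ _ ?_ ?_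
    · simp only [Category.assoc, hr₁, pullback.condition_assoc]
    · simp only [Category.assoc, hr₂, pullback.condition_assoc]
  refine ⟨𝒰.glueMorphisms r hglue, 𝒰.hom_ext _ _ fun i => ?_, 𝒰.hom_ext _ _ fun i => ?_⟩
  · rw [Scheme.Cover.ι_glueMorphisms_assoc, hr₁]
  · rw [Scheme.Cover.ι_glueMorphisms_assoc, hr₂]

namespace IsQuotient

variable {W W' Q Q' : Scheme.{u}} {j : W ⟶ X} {j' : W' ⟶ X} {π : W ⟶ Q} {π' : W' ⟶ Q'}

lemma effectiveEpi (hπ : IsQuotient p₁ p₂ j π) : EffectiveEpi π := by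
  have := hπ.flat
  have := hπ.locallyOfFinitePresentation
  have := hπ.surjective
  infer_instance

lemma exists_point (hπ : IsQuotient p₁ p₂ j π) {w w' : W} (h : π w = π w') :
    ∃ r, p₁ r = j w ∧ p₂ r = j w' := by
  obtain ⟨z, rfl, rfl⟩ := Scheme.Pullback.exists_preimage_pullback w w' h
  obtain ⟨k, h₁, h₂⟩ := (hπ.eq_iff _ _ _).mp (pullback.condition (f := π) (g := π))
  exact ⟨k z, by rw [← Scheme.Hom.comp_apply, h₁, Scheme.Hom.comp_apply],
    by rw [← Scheme.Hom.comp_apply, h₂, Scheme.Hom.comp_apply]⟩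

lemma existsUnique_map (hπ' : IsQuotient p₁ p₂ j' π') (hπ : IsQuotient p₁ p₂ j π) (k : W' ⟶ W)
    (hk : k ≫ j = j') : ∃! m : Q' ⟶ Q, π' ≫ m = k ≫ π := by
  have := hπ'.effectiveEpi
  refine ⟨EffectiveEpi.desc π' (k ≫ π) fun {T} a b hab => ?_, EffectiveEpi.fac _ _ _,
    fun m hm => EffectiveEpi.uniq _ _ _ _ hm⟩
  have h := (hπ'.eq_iff T a b).mp hab
  rw [← hk, ← Category.assoc, ← Category.assoc, ← hπ.eq_iff] at h
  simpa using h

lemma exists_iso {π' : W ⟶ Q'} (hπ : IsQuotient p₁ p₂ j π) (hπ' : IsQuotient p₁ p₂ j π') :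
    ∃ e : Q ≅ Q', π ≫ e.hom = π' := by
  obtain ⟨m, hm, -⟩ := hπ.existsUnique_map hπ' (𝟙 W) (Category.id_comp _)
  obtain ⟨m', hm', -⟩ := hπ'.existsUnique_map hπ (𝟙 W) (Category.id_comp _)
  have := hπ.effectiveEpi
  have := hπ'.effectiveEpi
  simp only [Category.id_comp] at hm hm'
  refine ⟨⟨m, m', ?_, ?_⟩, hm⟩
  · rw [← cancel_epi π, reassoc_of% hm, hm', Category.comp_id]
  · rw [← cancel_epi π', reassoc_of% hm', hm, Category.comp_id]

/-- A quotient of an open subset restricts to a smaller saturated open subset, as the preimage of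
its image under the quotient map. -/
lemma exists_restrict {U V : X.Opens} {π : V.toScheme ⟶ Q} (hπ : IsQuotient p₁ p₂ V.ι π)
    (hU : IsSaturated p₁ p₂ U) (hUV : U ≤ V) :
    ∃ (O : Q.Opens) (π' : U.toScheme ⟶ O), IsQuotient p₁ p₂ U.ι π' ∧
      π' ≫ O.ι = X.homOfLE hUV ≫ π := by
  have := hπ.isFinite
  have := hπ.flat
  have := hπ.locallyOfFinitePresentation
  have := hπ.surjective
  let O : Q.Opens := ⟨π '' (Set.range (X.homOfLE hUV)),
    π.isOpenMap _ (X.homOfLE hUV).isOpenEmbedding.isOpen_range⟩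
  have hO : π ⁻¹ᵁ O.ι.opensRange = (X.homOfLE hUV).opensRange := by
    rw [Scheme.Opens.opensRange_ι]
    ext v
    refine ⟨?_, fun hv => ⟨v, hv, rfl⟩⟩
    rintro ⟨_, ⟨y, rfl⟩, hy⟩
    obtain ⟨r, hr₁, hr₂⟩ := hπ.exists_point hy
    refine ⟨⟨v.1, ?_⟩, Subtype.ext ?_⟩
    · have : p₂ r = v.1 := hr₂
      rw [← this, ← hU.mem_iff, hr₁, ← Scheme.Hom.comp_apply, Scheme.homOfLE_ι]
      exact y.2
    · exact Scheme.homOfLE_apply _ _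
  let π' : U.toScheme ⟶ O := IsOpenImmersion.lift O.ι (X.homOfLE hUV ≫ π) (by
    rw [Scheme.Opens.range_ι]
    rintro _ ⟨y, rfl⟩
    exact ⟨_, ⟨y, rfl⟩, rfl⟩)
  have hπ' : π' ≫ O.ι = X.homOfLE hUV ≫ π := IsOpenImmersion.lift_fac _ _ _
  have hpb : IsPullback π' (X.homOfLE hUV) O.ι π :=
    IsOpenImmersion.isPullback _ _ _ _ hπ'.symm hO
  refine ⟨O, π', ⟨MorphismProperty.of_isPullback hpb.flip hπ.1,
    MorphismProperty.of_isPullback hpb.flip hπ.2,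
    MorphismProperty.of_isPullback hpb.flip hπ.3,
    MorphismProperty.of_isPullback hpb.flip hπ.4, fun T a b => ?_⟩, hπ'⟩
  rw [← cancel_mono O.ι, Category.assoc, Category.assoc, hπ', ← Category.assoc, ← Category.assoc,
    hπ.eq_iff, Category.assoc, Category.assoc, Scheme.homOfLE_ι]

lemma isOpenImmersion_map {U V : X.Opens} {π' : U.toScheme ⟶ Q'} {π : V.toScheme ⟶ Q}
    (hπ' : IsQuotient p₁ p₂ U.ι π') (hπ : IsQuotient p₁ p₂ V.ι π)
    (hU : IsSaturated p₁ p₂ U) (hUV : U ≤ V) (m : Q' ⟶ Q) (hm : π' ≫ m = X.homOfLE hUV ≫ π) :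
    IsOpenImmersion m := by
  obtain ⟨O, π'', hπ'', h⟩ := hπ.exists_restrict hU hUV
  obtain ⟨e, he⟩ := hπ'.exists_iso hπ''
  have := hπ'.effectiveEpi
  have : m = e.hom ≫ O.ι := by rw [← cancel_epi π', hm, reassoc_of% he, h]
  rw [this]
  infer_instance

end IsQuotient

variable (p₁ p₂) in
/-- The saturated open subsets that have a quotient. -/
abbrev QuotientOpens := {U : X.Opens // IsSaturated p₁ p₂ U ∧
  ∃ (Q : Scheme.{u}) (π : U.toScheme ⟶ Q), IsQuotient p₁ p₂ U.ι π}

namespace QuotientOpens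

/-- The diagram of the quotients of saturated open subsets. -/
noncomputable def diagram : QuotientOpens p₁ p₂ ⥤ Scheme.{u} where
  obj U := U.2.2.choose
  map {U V} f := (U.2.2.choose_spec.choose_spec.existsUnique_map V.2.2.choose_spec.choose_spec
    (X.homOfLE (leOfHom f)) (Scheme.homOfLE_ι _ _)).choose
  map_id U := ((U.2.2.choose_spec.choose_spec.existsUnique_map U.2.2.choose_spec.choose_spec _
    (Scheme.homOfLE_ι _ _)).choose_spec.2 _ (by simp)).symm
  map_comp {U V W} f g := ((U.2.2.choose_spec.choose_spec.existsUnique_map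
    W.2.2.choose_spec.choose_spec _ (Scheme.homOfLE_ι _ _)).choose_spec.2 _ (by
      have h₁ := (U.2.2.choose_spec.choose_spec.existsUnique_map V.2.2.choose_spec.choose_spec
        (X.homOfLE (leOfHom f)) (Scheme.homOfLE_ι _ _)).choose_spec.1
      have h₂ := (V.2.2.choose_spec.choose_spec.existsUnique_map W.2.2.choose_spec.choose_spec
        (X.homOfLE (leOfHom g)) (Scheme.homOfLE_ι _ _)).choose_spec.1
      simp only at h₁ h₂ ⊢
      rw [reassoc_of% h₁, h₂, Scheme.homOfLE_homOfLE_assoc])).symm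

/-- The quotient map of a saturated open subset. -/
noncomputable def quotientMap (U : QuotientOpens p₁ p₂) : U.1.toScheme ⟶ diagram.obj U :=
  U.2.2.choose_spec.choose

lemma isQuotient (U : QuotientOpens p₁ p₂) : IsQuotient p₁ p₂ U.1.ι U.quotientMap :=
  U.2.2.choose_spec.choose_spec

lemma quotientMap_map {U V : QuotientOpens p₁ p₂} (f : U ⟶ V) :
    U.quotientMap ≫ diagram.map f = X.homOfLE (leOfHom f) ≫ V.quotientMap :=
  (U.isQuotient.existsUnique_map V.isQuotient (X.homOfLE (leOfHom f))
    (Scheme.homOfLE_ι _ _)).choose_spec.1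

instance {U V : QuotientOpens p₁ p₂} (f : U ⟶ V) : IsOpenImmersion (diagram.map f) :=
  U.isQuotient.isOpenImmersion_map V.isQuotient U.2.1 (leOfHom f) _ (quotientMap_map f)

/-- The intersection of two saturated open subsets that have a quotient. -/
def inter (U V : QuotientOpens p₁ p₂) : QuotientOpens p₁ p₂ :=
  have h : IsSaturated p₁ p₂ (U.1 ⊓ V.1) := by
    have hU := U.2.1
    have hV := V.2.1
    rw [IsSaturated] at hU hV ⊢
    rw [Scheme.Hom.preimage_inf, Scheme.Hom.preimage_inf, hU, hV]
  ⟨U.1 ⊓ V.1, h, by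
    obtain ⟨O, π, hπ, -⟩ := U.isQuotient.exists_restrict h inf_le_left
    exact ⟨O, π, hπ⟩⟩

/-- The projection of an intersection to the first open subset. -/
def interLeft (U V : QuotientOpens p₁ p₂) : U.inter V ⟶ U :=
  homOfLE (inf_le_left : U.1 ⊓ V.1 ≤ U.1)

/-- The projection of an intersection to the second open subset. -/
def interRight (U V : QuotientOpens p₁ p₂) : U.inter V ⟶ V :=
  homOfLE (inf_le_right : U.1 ⊓ V.1 ≤ V.1)

lemma map_quotientMap_apply {U V : QuotientOpens p₁ p₂} (f : U ⟶ V) (x : U.1) :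
    diagram.map f (U.quotientMap x) = V.quotientMap ⟨x.1, leOfHom f x.2⟩ :=
  congr($(quotientMap_map f) x).trans
    (congrArg V.quotientMap (Subtype.ext (Scheme.homOfLE_apply _ _)))

instance : (diagram (p₁ := p₁) (p₂ := p₂) ⋙ Scheme.forget).IsLocallyDirected where
  cond {U V W} f g x y h := by
    obtain ⟨x, rfl⟩ := U.isQuotient.surjective.surj x
    obtain ⟨y, rfl⟩ := V.isQuotient.surjective.surj y
    have h' := (map_quotientMap_apply f x).symm.trans (h.trans (map_quotientMap_apply g y))
    obtain ⟨r, hr₁, hr₂⟩ := W.isQuotient.exists_point h'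
    have hr₁ : p₁ r = x.1 := hr₁
    have hr₂ : p₂ r = y.1 := hr₂
    have hy : y.1 ∈ U.1 := by
      rw [← hr₂, ← U.2.1.mem_iff, hr₁]
      exact x.2
    refine ⟨U.inter V, U.interLeft V, U.interRight V,
      (U.inter V).quotientMap ⟨y.1, hy, y.2⟩, ?_, ?_⟩
    · refine (map_quotientMap_apply (U.interLeft V) ⟨y.1, hy, y.2⟩).trans ?_
      apply (diagram.map f).isOpenEmbedding.injective
      exact (map_quotientMap_apply f _).trans (h'.symm.trans (map_quotientMap_apply f x).symm)
    · exact map_quotientMap_apply (U.interRight V) ⟨y.1, hy, y.2⟩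

/-- The glued quotient. -/
noncomputable abbrev glued (p₁ p₂ : R ⟶ X) : Scheme.{u} :=
  colimit (diagram (p₁ := p₁) (p₂ := p₂))

/-- The map from a saturated open subset to the glued quotient. -/
noncomputable def toGlued (U : QuotientOpens p₁ p₂) : U.1.toScheme ⟶ glued p₁ p₂ :=
  U.quotientMap ≫ colimit.ι diagram U

lemma homOfLE_toGlued {U V : QuotientOpens p₁ p₂} (f : U ⟶ V) :
    X.homOfLE (leOfHom f) ≫ V.toGlued = U.toGlued := by
  rw [toGlued, toGlued, ← colimit.w diagram f, ← reassoc_of% (quotientMap_map f)]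

lemma comp_toGlued_eq {U V : QuotientOpens p₁ p₂} {T : Scheme.{u}} (a : T ⟶ U.1) (b : T ⟶ V.1)
    (h : a ≫ U.1.ι = b ≫ V.1.ι) : a ≫ U.toGlued = b ≫ V.toGlued := by
  let c : T ⟶ (U.inter V).1 := IsOpenImmersion.lift (U.inter V).1.ι (a ≫ U.1.ι) (by
    rw [Scheme.Opens.range_ι]
    rintro _ ⟨t, rfl⟩
    refine ⟨(a t).2, ?_⟩
    rw [h]
    exact (b t).2)
  have hc : c ≫ (U.inter V).1.ι = a ≫ U.1.ι := IsOpenImmersion.lift_fac _ _ _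
  have ha : a = c ≫ X.homOfLE (leOfHom (U.interLeft V)) := by
    rw [← cancel_mono U.1.ι, Category.assoc, Scheme.homOfLE_ι, hc]
  have hb : b = c ≫ X.homOfLE (leOfHom (U.interRight V)) := by
    rw [← cancel_mono V.1.ι, Category.assoc, Scheme.homOfLE_ι, hc, h]
  rw [ha, hb, Category.assoc, Category.assoc, homOfLE_toGlued (U.interLeft V),
    homOfLE_toGlued (U.interRight V)]

end QuotientOpens

open QuotientOpens in
/-- Quotients of saturated open subsets that cover `X` glue to a quotient of `X`. -/
lemma IsRelation.exists_isQuotient_of_forall_exists (h : IsRelation p₁ p₂)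
    (H : ∀ x : X, ∃ U : QuotientOpens p₁ p₂, x ∈ U.1) :
    ∃ (Q : Scheme.{u}) (π : X ⟶ Q), IsQuotient p₁ p₂ (𝟙 X) π := by
  let 𝒰 : X.OpenCover := X.openCoverOfIsOpenCover (fun U : QuotientOpens p₁ p₂ => U.1)
    (.mk (eq_top_iff.mpr fun x _ => by
      obtain ⟨U, hU⟩ := H x
      exact TopologicalSpace.Opens.mem_iSup.mpr ⟨U, hU⟩))
  let π : X ⟶ glued p₁ p₂ := 𝒰.glueMorphisms (fun U => toGlued U)
    fun U V => comp_toGlued_eq _ _ pullback.condition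
  have hπ (U : QuotientOpens p₁ p₂) : U.1.ι ≫ π = U.quotientMap ≫ colimit.ι diagram U :=
    𝒰.ι_glueMorphisms _ _ U
  have hπ' {U : QuotientOpens p₁ p₂} (x : U.1) :
      π x.1 = colimit.ι diagram U (U.quotientMap x) := congr($(hπ U) x)
  have hpre (U : QuotientOpens p₁ p₂) :
      π ⁻¹ᵁ (colimit.ι diagram U).opensRange = U.1.ι.opensRange := by
    rw [Scheme.Opens.opensRange_ι]
    ext x
    refine ⟨?_, fun hx => ⟨U.quotientMap ⟨x, hx⟩, (hπ' ⟨x, hx⟩).symm⟩⟩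
    rintro ⟨y, hy⟩
    obtain ⟨V, hx⟩ := H x
    obtain ⟨L, f, g, z, hz₁, hz₂⟩ := Scheme.IsLocallyDirected.ι_eq_ι_iff _ |>.mp
      (hy.trans (hπ' ⟨x, hx⟩))
    obtain ⟨w, rfl⟩ := L.isQuotient.surjective.surj z
    obtain ⟨r, hr₁, hr₂⟩ := V.isQuotient.exists_point
      ((map_quotientMap_apply g w).symm.trans hz₂)
    have hr₁ : p₁ r = w.1 := hr₁
    have hr₂ : p₂ r = x := hr₂
    change x ∈ U.1
    rw [← hr₂, ← U.2.1.mem_iff, hr₁]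
    exact leOfHom f w.2
  have hpb (U : QuotientOpens p₁ p₂) :
      IsPullback U.quotientMap U.1.ι (colimit.ι diagram U) π :=
    IsOpenImmersion.isPullback _ _ _ _ (hπ U) (hpre U)
  let 𝒱 := Scheme.IsLocallyDirected.openCover (diagram (p₁ := p₁) (p₂ := p₂))
  have hlocal (P : MorphismProperty Scheme.{u}) [IsZariskiLocalAtTarget P]
      (hP : ∀ U : QuotientOpens p₁ p₂, P U.quotientMap) : P π := by
    refine IsZariskiLocalAtTarget.of_openCover 𝒱 fun U => ?_
    have := hP U
    rw [← (hpb U).flip.isoPullback_hom_snd, P.cancel_left_of_respectsIso] at this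
    exact this
  -- Instance search does not see that these predicates are morphism properties.
  have h₁ : IsZariskiLocalAtTarget @IsFinite.{u} :=
    @HasAffineProperty.instIsZariskiLocalAtTarget _ _
      IsFinite.instHasAffinePropertyAndIsAffineFiniteCarrierObjOppositeOpensCarrierCarrierCommRingCatPresheafOpOpensTopHomAppTop
  have h₂ : IsZariskiLocalAtTarget @Flat.{u} := by
    apply HasRingHomProperty.instIsZariskiLocalAtTarget
  have h₃ : IsZariskiLocalAtTarget @LocallyOfFinitePresentation.{u} := by
    apply HasRingHomProperty.instIsZariskiLocalAtTarget
  refine ⟨glued p₁ p₂, π, hlocal _ fun U => U.isQuotient.1, hlocal _ fun U => U.isQuotient.2,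
    hlocal _ fun U => U.isQuotient.3, hlocal _ fun U => U.isQuotient.4, fun T a b => ?_⟩
  rw [Category.comp_id, Category.comp_id]
  constructor
  · intro hab
    refine h.related_of_openCover (𝒱.pullback₁ (a ≫ π)) fun U => ?_
    let t := pullback.fst (a ≫ π) (colimit.ι diagram U)
    let s := pullback.snd (a ≫ π) (colimit.ι diagram U)
    have hs : t ≫ a ≫ π = s ≫ colimit.ι diagram U := pullback.condition
    have h₁ : (hpb U).lift s (t ≫ a) (by rw [Category.assoc, hs]) ≫ U.1.ι = t ≫ a :=
      (hpb U).lift_snd _ _ _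
    have h₂ : (hpb U).lift s (t ≫ b) (by rw [Category.assoc, ← hab, hs]) ≫ U.1.ι = t ≫ b :=
      (hpb U).lift_snd _ _ _
    change Related p₁ p₂ _ (t ≫ a) (t ≫ b)
    rw [← h₁, ← h₂, ← U.isQuotient.eq_iff, IsPullback.lift_fst, IsPullback.lift_fst]
  · rintro ⟨k, rfl, rfl⟩
    rw [Category.assoc, Category.assoc]
    congr 1
    refine Scheme.Cover.hom_ext (𝒰.pullback₁ p₁) _ _ fun U => ?_
    let t := pullback.fst p₁ U.1.ι
    let s := pullback.snd p₁ U.1.ι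
    have hs : t ≫ p₁ = s ≫ U.1.ι := pullback.condition
    let s' := IsOpenImmersion.lift U.1.ι (t ≫ p₂) (by
      rw [Scheme.Opens.range_ι]
      rintro _ ⟨z, rfl⟩
      have hz : p₁ (t z) = (s z).1 := congr($hs z)
      exact (U.2.1.mem_iff _).mp (hz ▸ (s z).2))
    have hs' : s' ≫ U.1.ι = t ≫ p₂ := IsOpenImmersion.lift_fac _ _ _
    change t ≫ p₁ ≫ π = t ≫ p₂ ≫ π
    have hss' := (isQuotient U).eq_iff _ s s' |>.mpr ⟨t, hs, hs'.symm⟩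
    rw [reassoc_of% hs, ← reassoc_of% hs']
    erw [hπ U]
    rw [reassoc_of% hss']

end Gluing

/-- An equivalence relation with finite locally free first projection such that every equivalence
class of points lies in an affine open subset has a quotient. -/
lemma IsRelation.exists_isQuotient_of_forall_isAffineOpen {R X : Scheme.{u}} {p₁ p₂ : R ⟶ X}
    (h : IsRelation p₁ p₂) [IsFinite p₁] [Flat p₁] [LocallyOfFinitePresentation p₁] [IsFinite p₂]
    (H : ∀ x : X, ∃ U : X.Opens, IsAffineOpen U ∧ p₁ '' (p₂ ⁻¹' {x}) ⊆ U) :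
    ∃ (Q : Scheme.{u}) (π : X ⟶ Q), IsQuotient p₁ p₂ (𝟙 X) π := by
  refine h.exists_isQuotient_of_forall_exists fun x => ?_
  obtain ⟨U, hU, hx⟩ := H x
  obtain ⟨W, hxW, hW, hWsat, n, b, hb⟩ := h.exists_isSaturated_isAffineOpen hU hx
  exact ⟨⟨W, hWsat, h.exists_isQuotient_of_isAffineOpen hW hWsat hb⟩, hxW⟩

/-! ### The quotient in the category of ringed spaces -/

section RingedSpace

lemma mono_appTop_of_epi {X Y : Scheme.{u}} (f : X ⟶ Y) [Epi f] : Mono f.appTop := by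
  refine ⟨fun {A} g h hgh => ?_⟩
  have key : Y.toSpecΓ ≫ Spec.map g = Y.toSpecΓ ≫ Spec.map h := by
    rw [← cancel_epi f, Scheme.toSpecΓ_naturality_assoc, Scheme.toSpecΓ_naturality_assoc,
      ← Spec.map_comp, ← Spec.map_comp, hgh]
  have := congr(Scheme.Hom.appTop $key)
  rw [Scheme.Hom.comp_appTop, Scheme.Hom.comp_appTop, Scheme.toSpecΓ_appTop,
    Scheme.ΓSpecIso_naturality, Scheme.ΓSpecIso_naturality, cancel_epi] at this
  exact this

/-- Functions descend along an effective epimorphism, as morphisms to affine schemes do. -/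
lemma exists_comp_appTop_eq {X Y : Scheme.{u}} (f : X ⟶ Y) [EffectiveEpi f] {A : CommRingCat.{u}}
    (g : A ⟶ Γ(X, ⊤)) (hg : g ≫ (pullback.fst f f).appTop = g ≫ (pullback.snd f f).appTop) :
    ∃ g' : A ⟶ Γ(Y, ⊤), g' ≫ f.appTop = g := by
  let φ : Y ⟶ Spec A := EffectiveEpi.desc f (X.toSpecΓ ≫ Spec.map g) fun {T} a b hab => by
    have h : pullback.fst f f ≫ X.toSpecΓ ≫ Spec.map g =
        pullback.snd f f ≫ X.toSpecΓ ≫ Spec.map g := by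
      rw [Scheme.toSpecΓ_naturality_assoc, Scheme.toSpecΓ_naturality_assoc, ← Spec.map_comp,
        ← Spec.map_comp, hg]
    have := pullback.lift a b hab ≫= h
    rwa [pullback.lift_fst_assoc, pullback.lift_snd_assoc] at this
  have hφ : f ≫ φ = X.toSpecΓ ≫ Spec.map g := EffectiveEpi.fac _ _ _
  refine ⟨(Scheme.ΓSpecIso A).inv ≫ φ.appTop, ?_⟩
  rw [Category.assoc, ← Scheme.Hom.comp_appTop, hφ, Scheme.Hom.comp_appTop, Scheme.toSpecΓ_appTop,
    Scheme.ΓSpecIso_naturality, Iso.inv_hom_id_assoc]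

variable {R X Q : Scheme.{u}} {p₁ p₂ : R ⟶ X} {π : X ⟶ Q}

lemma IsQuotient.comp_eq (hπ : IsQuotient p₁ p₂ (𝟙 X) π) : p₁ ≫ π = p₂ ≫ π :=
  (hπ.eq_iff _ _ _).mpr ⟨𝟙 R, by simp⟩

lemma IsQuotient.preimage_eq (hπ : IsQuotient p₁ p₂ (𝟙 X) π) (O : Q.Opens) :
    p₁ ⁻¹ᵁ (π ⁻¹ᵁ O) = p₂ ⁻¹ᵁ (π ⁻¹ᵁ O) := by
  rw [← Scheme.Hom.comp_preimage, hπ.comp_eq, Scheme.Hom.comp_preimage]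

lemma IsQuotient.effectiveEpi_morphismRestrict (hπ : IsQuotient p₁ p₂ (𝟙 X) π) (O : Q.Opens) :
    EffectiveEpi (π ∣_ O) := by
  have : Flat (π ∣_ O) :=
    MorphismProperty.of_isPullback (isPullback_morphismRestrict π O).flip hπ.flat
  have : LocallyOfFinitePresentation (π ∣_ O) :=
    MorphismProperty.of_isPullback (isPullback_morphismRestrict π O).flip
      hπ.locallyOfFinitePresentation
  have : Surjective (π ∣_ O) :=
    MorphismProperty.of_isPullback (isPullback_morphismRestrict π O).flip hπ.surjective
  infer_instance

lemma appTop_morphismRestrict_comp_topIso_hom (f : X ⟶ Q) (O : Q.Opens) :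
    (f ∣_ O).appTop ≫ (f ⁻¹ᵁ O).topIso.hom = O.topIso.hom ≫ f.app O := by
  rw [← Iso.inv_comp_eq, ← Category.assoc, ← Iso.eq_comp_inv]
  rw [morphismRestrict_appTop, Scheme.Opens.topIso_inv, Scheme.Opens.topIso_inv,
    Scheme.Hom.app_eq_appLE, Scheme.Hom.app_eq_appLE, Scheme.Hom.appLE_map]
  erw [Scheme.Hom.appLE_map, Scheme.Hom.map_appLE]
  rfl

lemma IsQuotient.mono_app (hπ : IsQuotient p₁ p₂ (𝟙 X) π) (O : Q.Opens) : Mono (π.app O) := by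
  have := hπ.effectiveEpi_morphismRestrict O
  have := mono_appTop_of_epi (π ∣_ O)
  have h := appTop_morphismRestrict_comp_topIso_hom π O
  rw [← Iso.inv_comp_eq] at h
  rw [← h]
  infer_instance

/-- The functions on the preimage of an open subset of `Q` that are invariant under the relation
descend to the open subset. -/
lemma IsQuotient.exists_comp_app_eq (hπ : IsQuotient p₁ p₂ (𝟙 X) π) (O : Q.Opens)
    {A : CommRingCat.{u}} (g : A ⟶ Γ(X, π ⁻¹ᵁ O)) (e : p₁ ⁻¹ᵁ (π ⁻¹ᵁ O) ≤ p₂ ⁻¹ᵁ (π ⁻¹ᵁ O))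
    (hg : g ≫ p₁.app (π ⁻¹ᵁ O) = g ≫ p₂.appLE (π ⁻¹ᵁ O) (p₁ ⁻¹ᵁ (π ⁻¹ᵁ O)) e) :
    ∃ g' : A ⟶ Γ(Q, O), g' ≫ π.app O = g := by
  have := hπ.effectiveEpi_morphismRestrict O
  have key : (g ≫ (π ⁻¹ᵁ O).topIso.inv) ≫ (pullback.fst (π ∣_ O) (π ∣_ O)).appTop =
      (g ≫ (π ⁻¹ᵁ O).topIso.inv) ≫ (pullback.snd (π ∣_ O) (π ∣_ O)).appTop := by
    obtain ⟨k, h₁, h₂⟩ := (hπ.eq_iff _ (pullback.fst (π ∣_ O) (π ∣_ O) ≫ (π ⁻¹ᵁ O).ι)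
      (pullback.snd (π ∣_ O) (π ∣_ O) ≫ (π ⁻¹ᵁ O).ι)).mp (by
        rw [Category.assoc, Category.assoc, ← morphismRestrict_ι, pullback.condition_assoc])
    rw [Category.comp_id] at h₁ h₂
    have htop (q : pullback (π ∣_ O) (π ∣_ O) ⟶ π ⁻¹ᵁ O) (p : R ⟶ X) (hq : k ≫ p = q ≫ (π ⁻¹ᵁ O).ι)
        (e₁ : p₁ ⁻¹ᵁ (π ⁻¹ᵁ O) ≤ p ⁻¹ᵁ (π ⁻¹ᵁ O)) (e₂ : ⊤ ≤ k ⁻¹ᵁ (p₁ ⁻¹ᵁ (π ⁻¹ᵁ O))) :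
        (π ⁻¹ᵁ O).topIso.inv ≫ q.appTop =
          p.appLE (π ⁻¹ᵁ O) (p₁ ⁻¹ᵁ (π ⁻¹ᵁ O)) e₁ ≫ k.appLE (p₁ ⁻¹ᵁ (π ⁻¹ᵁ O)) ⊤ e₂ := by
      have h : (π ⁻¹ᵁ O).topIso.inv = (π ⁻¹ᵁ O).ι.appLE (π ⁻¹ᵁ O) ⊤ (by simp) := by
        simp only [Scheme.Opens.topIso_inv, Scheme.Hom.appLE, Scheme.Opens.ι_app,
          Scheme.Opens.toScheme_presheaf_map]
        exact X.presheaf.map_comp _ _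
      have h' : q.appTop = q.appLE ⊤ ⊤ (show ⊤ ≤ q ⁻¹ᵁ ⊤ from le_rfl) :=
        Scheme.Hom.app_eq_appLE _
      rw [Scheme.Hom.appLE_comp_appLE, h, h']
      refine (Scheme.Hom.appLE_comp_appLE _ _ _ _ _ _ _).trans ?_
      simp only [hq]
    have e₂ : ⊤ ≤ k ⁻¹ᵁ (p₁ ⁻¹ᵁ (π ⁻¹ᵁ O)) := by
      rw [← Scheme.Hom.comp_preimage, h₁]
      exact fun z _ => (pullback.fst (π ∣_ O) (π ∣_ O) z).2
    rw [Category.assoc, Category.assoc, htop _ p₁ h₁ le_rfl e₂, htop _ p₂ h₂ e e₂,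
      ← Category.assoc, ← Category.assoc, ← hg, Scheme.Hom.appLE_eq_app]
  obtain ⟨g', hg'⟩ := exists_comp_appTop_eq (π ∣_ O) _ key
  refine ⟨g' ≫ O.topIso.hom, ?_⟩
  rw [Category.assoc, ← appTop_morphismRestrict_comp_topIso_hom, reassoc_of% hg',
    Iso.inv_hom_id, Category.comp_id]

lemma isCokernel_of_existsUnique {C : Type w} [Category.{v} C] {R X Q : C} {p₁ p₂ : R ⟶ X}
    {π : X ⟶ Q} (h : p₁ ≫ π = p₂ ≫ π)
    (H : ∀ (Z : C) (k : X ⟶ Z), p₁ ≫ k = p₂ ≫ k → ∃! m : Q ⟶ Z, π ≫ m = k) :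
    IsCokernel p₁ p₂ π := by
  choose m hm hm' using H
  exact ⟨h, ⟨Cofork.IsColimit.mk _ (fun s => m _ s.π s.condition)
    (fun s => hm _ s.π s.condition) fun s k hk => hm' _ s.π s.condition k hk⟩⟩

/-- A criterion for a cokernel of ringed spaces: it has the quotient topology, and its functions are
the invariant functions. -/
lemma isCokernel_ringedSpace {R X Q : RingedSpace.{u, u}} {p₁ p₂ : R ⟶ X} {π : X ⟶ Q}
    (h : p₁ ≫ π = p₂ ≫ π) (hπ : Topology.IsQuotientMap π.hom.base)
    (hp : ∀ x x' : X, π.hom.base x = π.hom.base x' →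
      ∃ r : R, p₁.hom.base r = x ∧ p₂.hom.base r = x')
    (hmono : ∀ O : TopologicalSpace.Opens Q, Mono (π.hom.c.app (op O)))
    (hlift : ∀ (O : TopologicalSpace.Opens Q) (A : CommRingCat.{u})
      (g : A ⟶ X.presheaf.obj (op ((TopologicalSpace.Opens.map π.hom.base).obj O)))
      (e : (TopologicalSpace.Opens.map (p₁ ≫ π).hom.base).obj O =
        (TopologicalSpace.Opens.map (p₂ ≫ π).hom.base).obj O),
      g ≫ p₁.hom.c.app _ = g ≫ p₂.hom.c.app _ ≫ R.presheaf.map (eqToHom e).op →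
      ∃ g', g' ≫ π.hom.c.app (op O) = g) : IsCokernel p₁ p₂ π := by
  refine isCokernel_of_existsUnique h fun Z k hk => ?_
  have hb (x x' : X) (hx : π.hom.base x = π.hom.base x') : k.hom.base x = k.hom.base x' := by
    obtain ⟨r, rfl, rfl⟩ := hp x x' hx
    exact congr(($hk).hom.base r)
  obtain ⟨b, hb⟩ : ∃ b : Q.carrier ⟶ Z.carrier, π.hom.base ≫ b = k.hom.base := by
    refine ⟨TopCat.ofHom (hπ.lift k.hom.base.hom hb), ?_⟩
    ext x
    exact DFunLike.congr_fun (hπ.lift_comp k.hom.base.hom hb) x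
  obtain ⟨⟨base, c⟩⟩ := k
  change _ = base at hb
  subst hb
  have hlift' (V : TopologicalSpace.Opens Z) :
      ∃ g : Z.presheaf.obj (op V) ⟶ Q.presheaf.obj (op ((TopologicalSpace.Opens.map b).obj V)),
        g ≫ π.hom.c.app _ = c.app (op V) := by
    have e : (TopologicalSpace.Opens.map (p₁ ≫ π).hom.base).obj
        ((TopologicalSpace.Opens.map b).obj V) =
          (TopologicalSpace.Opens.map (p₂ ≫ π).hom.base).obj
            ((TopologicalSpace.Opens.map b).obj V) := by
      rw [h]
    refine hlift _ _ (c.app (op V)) e ?_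
    have h₂ : (p₂ ≫ (⟨⟨π.hom.base ≫ b, c⟩⟩ : X ⟶ Z)).hom.c.app (op V) =
        c.app (op V) ≫ p₂.hom.c.app (op ((TopologicalSpace.Opens.map π.hom.base).obj
          ((TopologicalSpace.Opens.map b).obj V))) := rfl
    refine (SheafedSpace.congr_hom_app hk (op V)).trans ?_
    rw [h₂]
    refine (Category.assoc (c.app (op V)) (p₂.hom.c.app _) (R.presheaf.map _)).trans ?_
    congr 3
    exact Quiver.Hom.unop_inj (Subsingleton.elim _ _)
  choose g hg using hlift'
  let mc : Z.presheaf ⟶ (TopCat.Presheaf.pushforward _ b).obj Q.presheaf :=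
    { app V := g V.unop
      naturality V V' i := by
        have := hmono ((TopologicalSpace.Opens.map b).obj V'.unop)
        rw [← cancel_mono (π.hom.c.app (op ((TopologicalSpace.Opens.map b).obj V'.unop))),
          Category.assoc, hg]
        refine (c.naturality i).trans ?_
        refine Eq.trans ?_ (Category.assoc _ _ _).symm
        refine Eq.trans ?_ (congrArg (g V.unop ≫ ·)
          (π.hom.c.naturality ((TopologicalSpace.Opens.map b).map i.unop).op)).symm
        refine Eq.trans ?_ (Category.assoc _ _ _)
        rw [hg]
        rfl }
  refine ⟨⟨⟨b, mc⟩⟩, ?_, fun m' hm' => ?_⟩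
  · refine InducedCategory.Hom.ext (PresheafedSpace.hext _ _ rfl (heq_of_eq ?_))
    refine NatTrans.ext (funext fun V => ?_)
    exact hg V.unop
  · have hb' : m'.hom.base = b := by
      have := congr(($hm').hom.base)
      refine TopCat.hom_ext (ContinuousMap.ext fun y => ?_)
      obtain ⟨x, rfl⟩ := hπ.surjective y
      exact congr($this x)
    obtain ⟨⟨b', c'⟩⟩ := m'
    change b' = b at hb'
    subst hb'
    refine InducedCategory.Hom.ext (PresheafedSpace.hext _ _ rfl (heq_of_eq ?_))
    refine NatTrans.ext (funext fun V => ?_)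
    have := hmono ((TopologicalSpace.Opens.map b').obj V.unop)
    rw [← cancel_mono (π.hom.c.app (op ((TopologicalSpace.Opens.map b').obj V.unop)))]
    refine Eq.trans ?_ (hg _).symm
    have := SheafedSpace.congr_hom_app hm' V
    refine this.trans ?_
    refine (congrArg (c.app V ≫ ·) (X.presheaf.map_id _)).trans (Category.comp_id _)

/-- The quotient is a cokernel in the category of ringed spaces. -/
lemma IsQuotient.isCokernel_ringedSpace (hπ : IsQuotient p₁ p₂ (𝟙 X) π) :
    let F := Scheme.forgetToLocallyRingedSpace.{u} ⋙ LocallyRingedSpace.forgetToSheafedSpace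
    IsCokernel (F.map p₁) (F.map p₂) (F.map π) := by
  intro F
  have := hπ.isFinite
  have := hπ.flat
  have := hπ.surjective
  refine SchemeQuotient.isCokernel_ringedSpace
    (by rw [← F.map_comp, ← F.map_comp, hπ.comp_eq])
    (Flat.isQuotientMap_of_surjective π) (fun x x' h => hπ.exists_point h)
    (fun O => hπ.mono_app O) fun O A g e hg => ?_
  refine hπ.exists_comp_app_eq O g (hπ.preimage_eq O).le (hg.trans ?_)
  rfl

end RingedSpace

/-! ### Quotients of schemes over a base -/

section Over

variable {S : Scheme.{u}} {R X Q : Over S} {p₁ p₂ : R ⟶ X} {π : X ⟶ Q}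

lemma IsQuotient.eq_iff_over (hπ : IsQuotient p₁.left p₂.left (𝟙 X.left) π.left) {T : Over S}
    {a b : T ⟶ X} : a ≫ π = b ≫ π ↔ Related p₁ p₂ T a b := by
  have := hπ.eq_iff T.left a.left b.left
  rw [Category.comp_id, Category.comp_id] at this
  rw [Related.over, ← this]
  exact ⟨fun h => congr(($h).left), fun h => Over.OverMorphism.ext h⟩

/-- It suffices to test a quotient of `S`-schemes on points with values in `S`-schemes. -/
lemma IsQuotient.of_over [IsFinite π.left] [Flat π.left] [LocallyOfFinitePresentation π.left]
    [Surjective π.left] (h : ∀ (T : Over S) (a b : T ⟶ X), a ≫ π = b ≫ π ↔ Related p₁ p₂ T a b) :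
    IsQuotient p₁.left p₂.left (𝟙 X.left) π.left where
  isFinite := inferInstance
  flat := inferInstance
  locallyOfFinitePresentation := inferInstance
  surjective := inferInstance
  eq_iff T a b := by
    rw [Category.comp_id, Category.comp_id]
    by_cases hab : a ≫ X.hom = b ≫ X.hom
    · let a' : Over.mk (a ≫ X.hom) ⟶ X := Over.homMk a
      let b' : Over.mk (a ≫ X.hom) ⟶ X := Over.homMk b hab.symm
      refine Iff.trans ?_ ((h _ a' b').trans Related.over)
      exact ⟨fun h => Over.OverMorphism.ext h, fun h => congr(($h).left)⟩
    · refine iff_of_false (fun h => hab ?_) fun ⟨r, hr₁, hr₂⟩ => hab ?_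
      · rw [← Over.w π, reassoc_of% h]
      · rw [← hr₁, ← hr₂, Category.assoc, Category.assoc, Over.w, Over.w]

lemma IsQuotient.comp_eq_over (hπ : IsQuotient p₁.left p₂.left (𝟙 X.left) π.left) :
    p₁ ≫ π = p₂ ≫ π :=
  hπ.eq_iff_over.mpr ⟨𝟙 R, Category.id_comp _, Category.id_comp _⟩

/-- The quotient is a cokernel in the category of `S`-schemes, since `π` is a strict
epimorphism. -/
lemma IsQuotient.isCokernel_over (hπ : IsQuotient p₁.left p₂.left (𝟙 X.left) π.left) :
    IsCokernel p₁ p₂ π := by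
  have := hπ.effectiveEpi
  refine isCokernel_of_existsUnique hπ.comp_eq_over fun Z k hk => ?_
  have hk' {T : Scheme.{u}} (a b : T ⟶ X.left) (hab : a ≫ π.left = b ≫ π.left) :
      a ≫ k.left = b ≫ k.left := by
    have := (hπ.eq_iff T a b).mp hab
    rw [Category.comp_id, Category.comp_id] at this
    obtain ⟨r, rfl, rfl⟩ := this
    rw [Category.assoc, Category.assoc, ← Over.comp_left, ← Over.comp_left, hk]
  refine ⟨Over.homMk (EffectiveEpi.desc π.left k.left hk') ?_, ?_, fun m hm => ?_⟩
  · rw [← cancel_epi π.left, ← Category.assoc, EffectiveEpi.fac, Over.w, Over.w]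
  · exact Over.OverMorphism.ext (EffectiveEpi.fac π.left k.left hk')
  · exact Over.OverMorphism.ext (EffectiveEpi.uniq π.left k.left hk' _ congr(($hm).left))

lemma IsQuotient.isCokernel_toRingedSpace (hπ : IsQuotient p₁.left p₂.left (𝟙 X.left) π.left) :
    IsCokernel ((toRingedSpace S).map p₁) ((toRingedSpace S).map p₂) ((toRingedSpace S).map π) :=
  hπ.isCokernel_ringedSpace

lemma IsRelation.isIso_lift (hR : IsRelation p₁.left p₂.left)
    (hπ : IsQuotient p₁.left p₂.left (𝟙 X.left) π.left) (h : p₁ ≫ π = p₂ ≫ π) :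
    IsIso (pullback.lift p₁ p₂ h) := by
  obtain ⟨r, hr₁, hr₂⟩ := hπ.eq_iff_over.mp (pullback.condition (f := π) (g := π))
  refine ⟨r, Over.OverMorphism.ext (hR.hom_ext _ _ ?_ ?_), pullback.hom_ext ?_ ?_⟩
  · rw [← Over.comp_left, Category.assoc, hr₁, pullback.lift_fst, Over.id_left, Category.id_comp]
  · rw [← Over.comp_left, Category.assoc, hr₂, pullback.lift_snd, Over.id_left, Category.id_comp]
  · rw [Category.assoc, pullback.lift_fst, hr₁, Category.id_comp]
  · rw [Category.assoc, pullback.lift_snd, hr₂, Category.id_comp]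

lemma generate_singleton_mem_over (f : X ⟶ Q) [Flat f.left] [Surjective f.left]
    [LocallyOfFinitePresentation f.left] :
    Sieve.generate (Presieve.singleton f) ∈ (Scheme.fppfTopology.over S) Q := by
  rw [GrothendieckTopology.mem_over_iff]
  refine GrothendieckTopology.superset_covering _ ?_
    (Precoverage.generate_mem_toGrothendieck f.left.singleton_mem_fppfPrecoverage)
  rintro Z _ ⟨W, k, _, ⟨⟩, rfl⟩
  rw [Sieve.overEquiv_iff]
  exact ⟨X, Over.homMk k (by simp), f, ⟨⟩, Over.OverMorphism.ext rfl⟩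

/-- The quotient represents the fppf quotient sheaf: as `π` is an fppf covering with kernel pair
`R`, a section over `Q` of a sheaf is a section over `X` whose two pullbacks to `R` agree. -/
lemma IsQuotient.representsFppfQuotient
    (hπ : IsQuotient p₁.left p₂.left (𝟙 X.left) π.left) : RepresentsFppfQuotient p₁ p₂ π := by
  have := hπ.flat
  have := hπ.locallyOfFinitePresentation
  have := hπ.surjective
  refine ⟨hπ.comp_eq_over, ?_, fun G hG ψ => ?_, ?_, ⟨fun {T} a => ?_⟩⟩
  · rw [isSheaf_iff_isSheaf_of_type]
    exact GrothendieckTopology.Subcanonical.isSheaf_of_isRepresentable _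
  · rw [isSheaf_iff_isSheaf_of_type] at hG
    have hG' := hG _ (generate_singleton_mem_over π)
    rw [← Presieve.isSheafFor_iff_generate, Presieve.isSheafFor_singleton] at hG'
    have hψ {T : Over S} (a : T ⟶ X) :
        ψ.app (op T) (Quot.mk _ a) = G.map a.op (ψ.app (op X) (Quot.mk _ (𝟙 X))) := by
      refine Eq.trans ?_ (NatTrans.naturality_apply ψ a.op (Quot.mk _ (𝟙 X)))
      exact congrArg (fun b => ψ.app (op T) (Quot.mk _ b)) (Category.comp_id a).symm
    obtain ⟨y, hy, hy'⟩ := hG' (ψ.app (op X) (Quot.mk _ (𝟙 X))) fun {T} a b hab => by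
      rw [← hψ, ← hψ, Quot.sound (hπ.eq_iff_over.mp hab)]
    refine ⟨yonedaEquiv.symm y, ?_, fun χ hχ => ?_⟩
    · ext T a
      induction a using Quot.ind with | mk a
      refine Eq.trans ?_ (hψ a).symm
      rw [← hy, ← Functor.map_comp_apply]
      rfl
    · rw [Equiv.eq_symm_apply]
      refine hy' _ ?_
      subst hχ
      change _ = χ.app (op X) (𝟙 X ≫ π)
      rw [Category.id_comp]
      exact map_yonedaEquiv χ π
  · refine Presheaf.isLocallyInjective_of_injective _ _ fun T => ?_
    rintro ⟨a⟩ ⟨b⟩ hab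
    exact Quot.sound (hπ.eq_iff_over.mp hab)
  · have hp := (IsPullback.of_hasPullback π a).map (Over.forget S)
    have : Flat (pullback.snd π a).left := MorphismProperty.of_isPullback hp hπ.flat
    have : LocallyOfFinitePresentation (pullback.snd π a).left :=
      MorphismProperty.of_isPullback hp hπ.locallyOfFinitePresentation
    have : Surjective (pullback.snd π a).left := MorphismProperty.of_isPullback hp hπ.surjective
    refine GrothendieckTopology.superset_covering _ ?_
      (generate_singleton_mem_over (pullback.snd π a))
    rintro Z _ ⟨W, k, _, ⟨⟩, rfl⟩
    refine ⟨Quot.mk _ (k ≫ pullback.fst π a), ?_⟩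
    change (k ≫ pullback.fst π a) ≫ π = (k ≫ pullback.snd π a) ≫ a
    rw [Category.assoc, pullback.condition, Category.assoc]

lemma baseChange_fst {C : Type w} [Category.{v} C] [HasPullbacks C] {R X Q Q' : C} (p : R ⟶ X)
    (ρ : R ⟶ Q) (π : X ⟶ Q) (h : p ≫ π = ρ) (g : Q' ⟶ Q) :
    baseChange p ρ π h g ≫ pullback.fst π g = pullback.fst ρ g ≫ p :=
  pullback.lift_fst _ _ _

lemma baseChange_snd {C : Type w} [Category.{v} C] [HasPullbacks C] {R X Q Q' : C} (p : R ⟶ X)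
    (ρ : R ⟶ Q) (π : X ⟶ Q) (h : p ≫ π = ρ) (g : Q' ⟶ Q) :
    baseChange p ρ π h g ≫ pullback.snd π g = pullback.snd ρ g :=
  pullback.lift_snd _ _ _

/-- Quotients are stable under base change. -/
lemma IsQuotient.baseChange (hπ : IsQuotient p₁.left p₂.left (𝟙 X.left) π.left)
    (h : p₁ ≫ π = p₂ ≫ π) {Q' : Over S} (g : Q' ⟶ Q) :
    IsQuotient (baseChange p₁ (p₁ ≫ π) π rfl g).left (baseChange p₂ (p₁ ≫ π) π h.symm g).left
      (𝟙 (pullback π g).left) (pullback.snd π g).left := by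
  have hp := (IsPullback.of_hasPullback π g).map (Over.forget S)
  have : IsFinite (pullback.snd π g).left := MorphismProperty.of_isPullback hp hπ.isFinite
  have : Flat (pullback.snd π g).left := MorphismProperty.of_isPullback hp hπ.flat
  have : LocallyOfFinitePresentation (pullback.snd π g).left :=
    MorphismProperty.of_isPullback hp hπ.locallyOfFinitePresentation
  have : Surjective (pullback.snd π g).left := MorphismProperty.of_isPullback hp hπ.surjective
  refine .of_over fun T a b => ⟨fun hab => ?_, ?_⟩
  · have hab' : (a ≫ pullback.fst π g) ≫ π = (b ≫ pullback.fst π g) ≫ π := by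
      simp only [Category.assoc, pullback.condition, reassoc_of% hab]
    obtain ⟨r, hr₁, hr₂⟩ := hπ.eq_iff_over.mp hab'
    refine ⟨pullback.lift r (a ≫ pullback.snd π g) ?_, pullback.hom_ext ?_ ?_,
      pullback.hom_ext ?_ ?_⟩
    · rw [reassoc_of% hr₁, Category.assoc, pullback.condition]
    · rw [Category.assoc, baseChange_fst, pullback.lift_fst_assoc, hr₁]
    · rw [Category.assoc, baseChange_snd, pullback.lift_snd]
    · rw [Category.assoc, baseChange_fst, pullback.lift_fst_assoc, hr₂]
    · rw [Category.assoc, baseChange_snd, pullback.lift_snd, hab]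
  · rintro ⟨r, rfl, rfl⟩
    rw [Category.assoc, Category.assoc, baseChange_snd, baseChange_snd]

end Over

/-- The quotient of an equivalence relation of `S`-schemes exists in the category of `S`-schemes,
since the structure morphism of `X` descends along the quotient map. -/
lemma exists_isQuotient_over {S : Scheme.{u}} {R X : Over S} {p₁ p₂ : R ⟶ X}
    (hR : IsEquivalenceRelation p₁ p₂) [IsFinite p₁.left] [Flat p₁.left]
    [LocallyOfFinitePresentation p₁.left] [IsFinite p₂.left]
    (H : ∀ x : X.left, ∃ U : X.left.Opens, IsAffineOpen U ∧
      p₁.left '' (p₂.left ⁻¹' {x}) ⊆ (U : Set X.left)) :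
    ∃ (Q : Over S) (π : X ⟶ Q), IsQuotient p₁.left p₂.left (𝟙 X.left) π.left := by
  obtain ⟨Q, π, hπ⟩ := (isRelation_left hR).exists_isQuotient_of_forall_isAffineOpen H
  have := hπ.effectiveEpi
  have hX {T : Scheme.{u}} (a b : T ⟶ X.left) (hab : a ≫ π = b ≫ π) :
      a ≫ X.hom = b ≫ X.hom := by
    have := (hπ.eq_iff T a b).mp hab
    rw [Category.comp_id, Category.comp_id] at this
    obtain ⟨r, rfl, rfl⟩ := this
    rw [Category.assoc, Category.assoc, Over.w, Over.w]
  exact ⟨Over.mk (EffectiveEpi.desc π X.hom hX), Over.homMk π (EffectiveEpi.fac π X.hom hX), hπ⟩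

end SchemeQuotient

theorem mainTheorem1 (S : Scheme.{u}) (R X : Over S) (p₁ p₂ : R ⟶ X)
    (hR : IsEquivalenceRelation p₁ p₂)
    (hp₁ : IsFiniteLocallyFree p₁.left)
    (haff : ∀ x : X.left, ∃ U : X.left.Opens, IsAffineOpen U ∧
      p₁.left '' (p₂.left ⁻¹' {x}) ⊆ (U : Set X.left)) :
    IsFiniteLocallyFree p₂.left ∧
    ∃ (Q : Over S) (π : X ⟶ Q) (h : p₁ ≫ π = p₂ ≫ π),
      (IsCokernel p₁ p₂ π ∧
        IsCokernel ((toRingedSpace S).map p₁) ((toRingedSpace S).map p₂)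
          ((toRingedSpace S).map π)) ∧
      IsFiniteLocallyFree π.left ∧
      IsIso (pullback.lift p₁ p₂ h : R ⟶ pullback π π) ∧
      RepresentsFppfQuotient p₁ p₂ π ∧
      ∀ (Q' : Over S) (g : Q' ⟶ Q),
        IsCokernel (baseChange p₁ (p₁ ≫ π) π rfl g) (baseChange p₂ (p₁ ≫ π) π h.symm g)
          (pullback.snd π g) ∧
        IsCokernel ((toRingedSpace S).map (baseChange p₁ (p₁ ≫ π) π rfl g))
          ((toRingedSpace S).map (baseChange p₂ (p₁ ≫ π) π h.symm g))
          ((toRingedSpace S).map (pullback.snd π g)) ∧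
        RepresentsFppfQuotient (baseChange p₁ (p₁ ≫ π) π rfl g)
          (baseChange p₂ (p₁ ≫ π) π h.symm g) (pullback.snd π g) := by
  have hrel := isRelation_left hR
  have h₁ := isFiniteLocallyFree_iff.mp hp₁
  obtain ⟨_, _, _⟩ := h₁
  obtain ⟨e, he⟩ := hrel.exists_iso
  have hp₂ : IsFinite p₂.left ∧ Flat p₂.left ∧ LocallyOfFinitePresentation p₂.left := by
    rw [← he]
    exact ⟨inferInstance, inferInstance, inferInstance⟩
  have := hp₂.1
  obtain ⟨Q, π, hπ⟩ := exists_isQuotient_over hR haff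
  refine ⟨isFiniteLocallyFree_iff.mpr hp₂, Q, π, hπ.comp_eq_over,
    ⟨hπ.isCokernel_over, hπ.isCokernel_toRingedSpace⟩,
    isFiniteLocallyFree_iff.mpr ⟨hπ.isFinite, hπ.flat, hπ.locallyOfFinitePresentation⟩,
    hrel.isIso_lift hπ _, hπ.representsFppfQuotient, fun Q' g => ?_⟩
  have hg := hπ.baseChange hπ.comp_eq_over g
  exact ⟨hg.isCokernel_over, hg.isCokernel_toRingedSpace, hg.representsFppfQuotient⟩
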